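/- Consider the two-user fading vector multiple access channel $\mathbf y=\mathbf h_1x_1+\mathbf h_2x_2+\mathbf z$ with $N_r\ge 1$ receive antennas, noise covariance $\sigma^2\mathbf I$ with $\sigma^2>0$, channel vectors $\mathbf h_1,\mathbf h_2\in\mathbb R^{N_r}$ known to everybody, whose joint (stationary) law has a density with respect to Lebesgue measure and satisfies $E\log(1+\|\mathbf h_i\|^2)<\infty$, $i=1,2$. Let $\bar P_1,\bar P_2>0$, and let $\mathcal F_i$ be the set of measurable power control policies $\mathcal P_i(\mathbf h_1,\mathbf h_2)\ge 0$ with $E[\mathcal P_i]\le\bar P_i$. Policies that agree almost surely are identified. A base-station strategy is a measurable set $D_1$ of fading states $(\mathbf h_1,\mathbf h_2)$: user 1 is decoded first on $D_1$, user 2 is decoded first on $D_1^c$. In the low-level game user $i$ chooses $\mathcal P_i\in\mathcal F_i$ and has payoff $$\bar R_1(D_1,\mathcal P_1,\mathcal P_2)=E\Big[\tfrac12\log_2\frac{\det(\sigma^2\mathbf I+\mathcal P_1\mathbf h_1\mathbf h_1^T+I_{D_1}\mathcal P_2\mathbf h_2\mathbf h_2^T)}{\det(\sigma^2\mathbf I+I_{D_1}\mathcal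 P_2\mathbf h_2\mathbf h_2^T)}\Big],\qquad \bar R_2(D_1,\mathcal P_1,\mathcal P_2)=E\Big[\tfrac12\log_2\frac{\det(\sigma^2\mathbf I+I_{D_1^c}\mathcal P_1\mathbf h_1\mathbf h_1^T+\mathcal P_2\mathbf h_2\mathbf h_2^T)}{\det(\sigma^2\mathbf I+I_{D_1^c}\mathcal P_1\mathbf h_1\mathbf h_1^T)}\Big].$$ A Nash equilibrium is admissible if no other Nash equilibrium is at least as good for both users and strictly better for at least one. The rate pairs achieved by the Stackelberg game are the pairs $(\bar R_1,\bar R_2)$ at admissible Nash equilibria of the low-level games, over all $D_1$. With $J(\mathcal P_1,\mathcal P_2)=E\big[\tfrac12\log_2\det\big(\mathbf I+\sigma^{-2}(\mathcal P_1\mathbf h_1\mathbf h_1^T+\mathcal P_2\mathbf h_2\mathbf h_2^T)\big)\big]$, the capacity region is $$\mathcal G_c=\bigcup_{\mathcal P_1\in\mathcal F_1,\,\mathcal P_2\in\mathcal F_2}\{(R_1,R_2):R_1,R_2\ge0,\ R_1\le J(\mathcal P_1,0),\ R_2\le J(0,\mathcal P_2),\ R_1+R_2\le J(\mathcal P_1,\mathcal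 P_2)\}.$$ Its corner point $CR_i$ is the point at which $R_i$ is maximal over $\mathcal G_c$ and the other rate is the largest one compatible with this; its maximum sum-rate points are the points of $\mathcal G_c$ that maximize $R_1+R_2$ over $\mathcal G_c$. Then: 1. For every base-station strategy $D_1$ the low-level game has exactly one admissible Nash equilibrium. 2. The Stackelberg game achieves both corner points $CR_1$ and $CR_2$. 3. Maximum sum-rate points exist. If, for some $D_1$, the rate pair at the admissible Nash equilibrium is a maximum sum-rate point, then at this equilibrium almost surely at most one user transmits in each fading state. If moreover $N_r\ge2$ and there are nonempty connected open sets $U_1,U_2\subset\mathbb R^{N_r}$ such that, up to null sets, the density of $(\mathbf h_1,\mathbf h_2)$ is positive exactly on $U_1\times U_2$, then the Stackelberg game achieves no maximum sum-rate point. -/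

import Mathlib

open MeasureTheory

noncomputable section

/-- A joint fading state `(h₁, h₂)`: the channel vectors of users 1 and 2 at `n` receive
antennas. -/
abbrev FadingState (n : ℕ) : Type :=
  EuclideanSpace ℝ (Fin n) × EuclideanSpace ℝ (Fin n)

/-- The data of a two-user fading vector multiple access channel with `n` receive antennas:
the (stationary) joint law of the fading vectors, the noise variance `σ²` per antenna, and the
average power constraints of the two users. -/
structure VectorMAC (n : ℕ) where
  law : Measure (FadingState n)
  noiseVar : ℝ
  power₁ : ℝ
  power₂ : ℝ

namespace VectorMAC

variable {n : ℕ} (C : VectorMAC n)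

/-- `σ² I + p h₁ h₁ᵀ + q h₂ h₂ᵀ`. -/
def receivedCov (p q : ℝ) (H : FadingState n) : Matrix (Fin n) (Fin n) ℝ :=
  C.noiseVar • (1 : Matrix (Fin n) (Fin n) ℝ)
    + p • Matrix.vecMulVec (fun k => H.1 k) (fun k => H.1 k)
    + q • Matrix.vecMulVec (fun k => H.2 k) (fun k => H.2 k)

/-- Feasible power control policies for an average power constraint `Pbar`. -/
structure IsFeasible (Pbar : ℝ) (P : FadingState n → ℝ) : Prop where
  measurable : Measurable P
  nonneg : ∀ H, 0 ≤ P H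
  integrable : Integrable P C.law
  average_le : ∫ H, P H ∂C.law ≤ Pbar

/-- Payoff of user 1. User 1 is decoded first on `D`, so the signal of user 2 is interference
for user 1 exactly on `D`. -/
def rate₁ (D : Set (FadingState n)) (P₁ P₂ : FadingState n → ℝ) : ℝ :=
  ∫ H, ((1 / 2) * Real.logb 2 (C.receivedCov (P₁ H) (D.indicator P₂ H) H).det
      - (1 / 2) * Real.logb 2 (C.receivedCov 0 (D.indicator P₂ H) H).det) ∂C.law

/-- Payoff of user 2. User 2 is decoded first on `Dᶜ`, so the signal of user 1 is interference
for user 2 exactly on `Dᶜ`. -/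
def rate₂ (D : Set (FadingState n)) (P₁ P₂ : FadingState n → ℝ) : ℝ :=
  ∫ H, ((1 / 2) * Real.logb 2 (C.receivedCov (Dᶜ.indicator P₁ H) (P₂ H) H).det
      - (1 / 2) * Real.logb 2 (C.receivedCov (Dᶜ.indicator P₁ H) 0 H).det) ∂C.law

/-- Nash equilibria of the low-level game, given the base-station strategy `D`. -/
structure IsNash (D : Set (FadingState n)) (P₁ P₂ : FadingState n → ℝ) : Prop where
  feasible₁ : C.IsFeasible C.power₁ P₁
  feasible₂ : C.IsFeasible C.power₂ P₂
  best₁ : ∀ Q₁, C.IsFeasible C.power₁ Q₁ → C.rate₁ D Q₁ P₂ ≤ C.rate₁ D P₁ P₂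
  best₂ : ∀ Q₂, C.IsFeasible C.power₂ Q₂ → C.rate₂ D P₁ Q₂ ≤ C.rate₂ D P₁ P₂

/-- A Nash equilibrium is admissible if no Nash equilibrium is at least as good for both users
and strictly better for one of them. -/
def IsAdmissibleNash (D : Set (FadingState n)) (P₁ P₂ : FadingState n → ℝ) : Prop :=
  C.IsNash D P₁ P₂ ∧
    ¬ ∃ Q₁ Q₂, C.IsNash D Q₁ Q₂ ∧
      C.rate₁ D P₁ P₂ ≤ C.rate₁ D Q₁ Q₂ ∧ C.rate₂ D P₁ P₂ ≤ C.rate₂ D Q₁ Q₂ ∧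
      (C.rate₁ D P₁ P₂ < C.rate₁ D Q₁ Q₂ ∨ C.rate₂ D P₁ P₂ < C.rate₂ D Q₁ Q₂)

/-- The Stackelberg achievable region: rate pairs at admissible Nash equilibria of the low-level
game, over all base-station strategies `D`. -/
def stackelbergRegion : Set (ℝ × ℝ) :=
  {r | ∃ (D : Set (FadingState n)) (P₁ P₂ : FadingState n → ℝ), MeasurableSet D ∧
    C.IsAdmissibleNash D P₁ P₂ ∧ r = (C.rate₁ D P₁ P₂, C.rate₂ D P₁ P₂)}

/-- `E[½ log₂ det (I + (P₁ h₁ h₁ᵀ + P₂ h₂ h₂ᵀ) / σ²)]`. -/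
def sumInfo (P₁ P₂ : FadingState n → ℝ) : ℝ :=
  ∫ H, (1 / 2) * Real.logb 2
    ((1 : Matrix (Fin n) (Fin n) ℝ) + C.noiseVar⁻¹ •
      (P₁ H • Matrix.vecMulVec (fun k => H.1 k) (fun k => H.1 k)
        + P₂ H • Matrix.vecMulVec (fun k => H.2 k) (fun k => H.2 k))).det ∂C.law

/-- The capacity region with channel state information at the transmitters and the receiver:
the union over feasible power control policies of the ergodic multiple-access pentagons. -/
def capacityRegion : Set (ℝ × ℝ) :=
  {r | 0 ≤ r.1 ∧ 0 ≤ r.2 ∧ ∃ P₁ P₂ : FadingState n → ℝ,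
    C.IsFeasible C.power₁ P₁ ∧ C.IsFeasible C.power₂ P₂ ∧
    r.1 ≤ C.sumInfo P₁ 0 ∧ r.2 ≤ C.sumInfo 0 P₂ ∧ r.1 + r.2 ≤ C.sumInfo P₁ P₂}

/-- The corner point at which user 1 has the largest rate in the capacity region and user 2 has
the largest rate compatible with this. -/
def IsCornerPoint₁ (r : ℝ × ℝ) : Prop :=
  r ∈ C.capacityRegion ∧
    ∀ s ∈ C.capacityRegion, s.1 ≤ r.1 ∧ (s.1 = r.1 → s.2 ≤ r.2)

/-- The corner point at which user 2 has the largest rate in the capacity region and user 1 has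
the largest rate compatible with this. -/
def IsCornerPoint₂ (r : ℝ × ℝ) : Prop :=
  r ∈ C.capacityRegion ∧
    ∀ s ∈ C.capacityRegion, s.2 ≤ r.2 ∧ (s.2 = r.2 → s.1 ≤ r.1)

/-- The points of the capacity region at which the sum of the rates is maximal. -/
def IsMaxSumRatePoint (r : ℝ × ℝ) : Prop :=
  r ∈ C.capacityRegion ∧ ∀ s ∈ C.capacityRegion, s.1 + s.2 ≤ r.1 + r.2

/-- Up to null sets, the fading density is positive exactly on a product of two nonempty
connected open sets of channel vectors. -/
def HasConnectedProductSupport : Prop :=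
  ∃ U₁ U₂ : Set (EuclideanSpace ℝ (Fin n)),
    IsOpen U₁ ∧ IsConnected U₁ ∧ IsOpen U₂ ∧ IsConnected U₂ ∧
    C.law (U₁ ×ˢ U₂)ᶜ = 0 ∧ (volume.restrict (U₁ ×ˢ U₂)) ≪ C.law

end VectorMAC

end

/-! Up to a factor $\sigma^{2n}$ the determinants equal $1+pa+qb+pqd$, where $a,b$ are the
normalized gains and $d$ the Gram determinant of the two channels. A user facing interference power
$q$ therefore sees a scalar channel with effective gain $(a+qd)/(1+qb)$, and its best response is
water-filling, unique up to null sets.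

Unique admissible equilibrium. On $D$ user 2 suffers no interference and on $D^c$ user 1 suffers
none, so the interference that each causes depends only on its own water level. Equilibria thus
yield solutions of two power equations in two levels. The power of each user decreases in the level
of the other, so the pairs of levels that spend at least the budgets are stable under coordinatewise
minimum; the least such pair solves both equations (`exists_least_level_pair`). It gives the least
interference to both users, hence an equilibrium that dominates all others, strictly unless they
agree (`exists_dominating_equilibrium`).

Corner points. For $D=\emptyset$ user 1 plays its unique single-user optimum and user 2 answers it
optimally; $D$ the whole space is symmetric.

Maximum sum rate. The joint information is concave in the powers. A maximizing sequence that
converges almost surely comes from a strictly concave auxiliary functional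
(`exists_seq_mem_tendsto_ae`), and Fatou's lemma passes to the limit.

Time sharing. For every $D$ the two rates add up to the joint information. An equilibrium that
maximizes it is therefore also optimal for each user under full interference, so the user that is
interference-free in a state obeys two water-filling laws at once. Where both users transmit,
eliminating the powers leaves a polynomial relation among $a,b,d$ (`IsCoupled`). Each ray of channel
vectors meets it at most once off a null set, so it has probability zero. On a connected product
support the intermediate value theorem gives a state with $xa=yb>1$, which can be chosen with
non-parallel channels. Near it neither user alone can keep the other silent, which contradicts time
sharing. -/

namespace FadingMAC

/-! ### Single-user water-filling -/

variable {Ω : Type*} [MeasurableSpace Ω]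

/-- Measurable power policies with average power at most `c`. -/
structure IsPolicy (μ : Measure Ω) (c : ℝ) (P : Ω → ℝ) : Prop where
  measurable : Measurable P
  nonneg : ∀ ω, 0 ≤ P ω
  integrable : Integrable P μ
  average_le : ∫ ω, P ω ∂μ ≤ c

/-- An almost surely positive power gain with integrable logarithm. -/
structure IsGain (μ : Measure Ω) (g : Ω → ℝ) : Prop where
  measurable : Measurable g
  nonneg : ∀ ω, 0 ≤ g ω
  pos : ∀ᵐ ω ∂μ, 0 < g ω
  integrable_log : Integrable (fun ω => Real.log (1 + g ω)) μ

/-- `E[log (1 + P g)]`. -/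
noncomputable def logValue (μ : Measure Ω) (g P : Ω → ℝ) : ℝ :=
  ∫ ω, Real.log (1 + P ω * g ω) ∂μ

/-- `P` maximizes `E[log (1 + P g)]` subject to an average power constraint. -/
structure IsBestResponse (μ : Measure Ω) (c : ℝ) (g P : Ω → ℝ) : Prop where
  isPolicy : IsPolicy μ c P
  le : ∀ Q, IsPolicy μ c Q → logValue μ g Q ≤ logValue μ g P

/-- The water-filling power at water level `ν` over a channel with gain `g`. -/
noncomputable def waterfill (ν g : ℝ) : ℝ := max (ν - g⁻¹) 0

lemma waterfill_nonneg (ν g : ℝ) : 0 ≤ waterfill ν g := le_max_right _ _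

lemma waterfill_mono_level {ν ν' : ℝ} (h : ν ≤ ν') (g : ℝ) : waterfill ν g ≤ waterfill ν' g :=
  max_le_max (by linarith) le_rfl

lemma waterfill_mono_gain (ν : ℝ) {g g' : ℝ} (hg : 0 < g) (h : g ≤ g') :
    waterfill ν g ≤ waterfill ν g' :=
  max_le_max (sub_le_sub_left (inv_anti₀ hg h) _) le_rfl

lemma waterfill_of_nonpos {ν g : ℝ} (hν : ν ≤ 0) (hg : 0 ≤ g) : waterfill ν g = 0 :=
  max_eq_right (by have := inv_nonneg.2 hg; linarith)

lemma waterfill_le_abs {ν g : ℝ} (hg : 0 ≤ g) : waterfill ν g ≤ |ν| :=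
  max_le (by have := inv_nonneg.2 hg; have := le_abs_self ν; linarith) (abs_nonneg _)

lemma waterfill_eq_of_pos {ν g : ℝ} (h : 0 < waterfill ν g) : waterfill ν g = ν - g⁻¹ := by
  unfold waterfill at *
  rcases max_choice (ν - g⁻¹) 0 with h' | h' <;> rw [h'] at h ⊢
  exact absurd h (lt_irrefl _)

lemma waterfill_eq_zero_iff {ν g : ℝ} : waterfill ν g = 0 ↔ ν ≤ g⁻¹ := by
  unfold waterfill
  rw [max_eq_right_iff, sub_nonpos]

lemma measurable_waterfill (ν : ℝ) {g : Ω → ℝ} (hg : Measurable g) :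
    Measurable fun ω => waterfill ν (g ω) :=
  (measurable_const.sub hg.inv).max measurable_const

/-- Tangent line at the water-filling power, with Lagrange multiplier $1/\nu$: the slope $g/(1+pg)$
equals $1/\nu$ when $p>0$ and is at most $1/\nu$ when $p=0$, where only $q\ge0$ is allowed. -/
lemma log_one_add_le_of_waterfill {ν g q : ℝ} (hν : 0 < ν) (hg : 0 < g) (hq : 0 ≤ q) :
    Real.log (1 + q * g) ≤
      Real.log (1 + waterfill ν g * g) + (q - waterfill ν g) / ν := by
  set p := waterfill ν g with hp
  have hp0 : 0 ≤ p := waterfill_nonneg _ _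
  have hB : 0 < 1 + p * g := by positivity
  have hA : 0 < 1 + q * g := by positivity
  have h1 : Real.log (1 + q * g) - Real.log (1 + p * g) ≤ (1 + q * g) / (1 + p * g) - 1 := by
    rw [← Real.log_div hA.ne' hB.ne']
    exact Real.log_le_sub_one_of_pos (by positivity)
  have h2 : (1 + q * g) / (1 + p * g) - 1 ≤ (q - p) / ν := by
    have h3 : (1 + q * g) / (1 + p * g) - 1 = (q - p) * (g / (1 + p * g)) := by
      field_simp; ring
    rw [h3, div_eq_mul_inv (q - p) ν]
    rcases hp0.lt_or_eq with h | h
    · have : p = ν - g⁻¹ := waterfill_eq_of_pos h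
      have h4 : g / (1 + p * g) = ν⁻¹ := by
        rw [this]; field_simp; ring
      rw [h4]
    · rw [← h]
      have : ν ≤ g⁻¹ := waterfill_eq_zero_iff.1 (hp ▸ h.symm)
      have h5 : g ≤ ν⁻¹ := by
        have := inv_anti₀ hν this
        rwa [inv_inv] at this
      simpa using mul_le_mul_of_nonneg_left h5 hq
  linarith

/-- Strict concavity: if the tangent bound were attained at a second point, the midpoint would
violate it. -/
lemma eq_waterfill_of_log_eq {ν g q : ℝ} (hν : 0 < ν) (hg : 0 < g) (hq : 0 ≤ q)
    (h : Real.log (1 + waterfill ν g * g) + (q - waterfill ν g) / ν ≤ Real.log (1 + q * g)) :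
    q = waterfill ν g := by
  by_contra hne
  set p := waterfill ν g with hp
  have hp0 : 0 ≤ p := waterfill_nonneg _ _
  have hm := log_one_add_le_of_waterfill hν hg (q := (q + p) / 2) (by positivity)
  rw [← hp] at hm
  have hB : 0 < 1 + p * g := by positivity
  have hA : 0 < 1 + q * g := by positivity
  have hM : (1 + q * g) * (1 + p * g) < (1 + (q + p) / 2 * g) ^ 2 := by
    have : 0 < ((q - p) * g) ^ 2 := by
      have := sub_ne_zero.2 hne
      positivity
    nlinarith
  have hl := Real.log_lt_log (by positivity) hM
  rw [Real.log_mul hA.ne' hB.ne', Real.log_pow] at hl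
  push_cast at hl
  have : (((q + p) / 2) - p) / ν = (q - p) / ν / 2 := by ring
  rw [this] at hm
  linarith

lemma log_one_add_mul_le {p g : ℝ} (hp : 0 ≤ p) (hg : 0 ≤ g) :
    Real.log (1 + p * g) ≤ Real.log (1 + p) + Real.log (1 + g) := by
  rw [← Real.log_mul (by positivity) (by positivity)]
  exact Real.log_le_log (by positivity) (by nlinarith)

lemma log_one_add_le_self {p : ℝ} (hp : 0 ≤ p) : Real.log (1 + p) ≤ p := by
  have := Real.log_le_sub_one_of_pos (show 0 < 1 + p by positivity)
  linarith

lemma log_one_add_nonneg {p : ℝ} (hp : 0 ≤ p) : 0 ≤ Real.log (1 + p) :=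
  Real.log_nonneg (by linarith)

variable {μ : Measure Ω} {c : ℝ} {g P Q : Ω → ℝ}

lemma IsGain.integrable_log_one_add_mul (hg : IsGain μ g) (hP : IsPolicy μ c P) :
    Integrable (fun ω => Real.log (1 + P ω * g ω)) μ := by
  refine (hP.integrable.add hg.integrable_log).mono'
    (((hP.measurable.mul hg.measurable).const_add 1).log.aestronglyMeasurable)
    (Filter.Eventually.of_forall fun ω => ?_)
  have h1 := hP.nonneg ω
  have h2 := hg.nonneg ω
  rw [Real.norm_eq_abs, abs_of_nonneg (log_one_add_nonneg (by positivity))]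
  exact (log_one_add_mul_le h1 h2).trans (by simpa using log_one_add_le_self h1)

lemma logValue_congr_policy (h : P =ᵐ[μ] Q) : logValue μ g P = logValue μ g Q :=
  integral_congr_ae (by filter_upwards [h] with ω h; simp [h])

lemma logValue_congr_gain {g' : Ω → ℝ} (h : g =ᵐ[μ] g') : logValue μ g P = logValue μ g' P :=
  integral_congr_ae (by filter_upwards [h] with ω h; simp [h])

lemma logValue_mono_gain {g' : Ω → ℝ} (hg : IsGain μ g) (hg' : IsGain μ g')
    (h : g ≤ᵐ[μ] g') (hP : IsPolicy μ c P) : logValue μ g P ≤ logValue μ g' P := by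
  refine integral_mono_ae (hg.integrable_log_one_add_mul hP) (hg'.integrable_log_one_add_mul hP) ?_
  filter_upwards [h] with ω h
  have := hP.nonneg ω
  have := hg.nonneg ω
  exact Real.log_le_log (by positivity) (by gcongr)

lemma integrable_waterfill [IsFiniteMeasure μ] (ν : ℝ) (hg : IsGain μ g) :
    Integrable (fun ω => waterfill ν (g ω)) μ := by
  refine (integrable_const |ν|).mono' (measurable_waterfill ν hg.measurable).aestronglyMeasurable
    (Filter.Eventually.of_forall fun ω => ?_)
  rw [Real.norm_eq_abs, abs_of_nonneg (waterfill_nonneg _ _)]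
  exact waterfill_le_abs (hg.nonneg ω)

lemma isPolicy_waterfill [IsFiniteMeasure μ] {ν : ℝ} (hg : IsGain μ g)
    (h : ∫ ω, waterfill ν (g ω) ∂μ = c) : IsPolicy μ c fun ω => waterfill ν (g ω) :=
  ⟨measurable_waterfill ν hg.measurable, fun _ => waterfill_nonneg _ _,
    integrable_waterfill ν hg, h.le⟩

/-- Integrating the tangent bound leaves the term $(E[Q]-c)/\nu\le0$. Equality of the values forces
equality in the pointwise bound almost everywhere, hence equality of the policies. -/
lemma logValue_le_waterfill_add [IsFiniteMeasure μ] {ν : ℝ} (hν : 0 < ν) (hg : IsGain μ g)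
    (hc : ∫ ω, waterfill ν (g ω) ∂μ = c) (hQ : IsPolicy μ c Q) :
    logValue μ g Q ≤ logValue μ g (fun ω => waterfill ν (g ω)) ∧
      (logValue μ g (fun ω => waterfill ν (g ω)) ≤ logValue μ g Q →
        Q =ᵐ[μ] fun ω => waterfill ν (g ω)) := by
  set W := fun ω => waterfill ν (g ω) with hW
  have hWp : IsPolicy μ c W := isPolicy_waterfill hg hc
  have i1 := hg.integrable_log_one_add_mul hWp
  have i2 := hg.integrable_log_one_add_mul hQ
  have i3 : Integrable (fun ω => (Q ω - W ω) / ν) μ := (hQ.integrable.sub hWp.integrable).div_const ν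
  have hle : (fun ω => Real.log (1 + Q ω * g ω)) ≤ᵐ[μ]
      fun ω => Real.log (1 + W ω * g ω) + (Q ω - W ω) / ν := by
    filter_upwards [hg.pos] with ω hω
    exact log_one_add_le_of_waterfill hν hω (hQ.nonneg ω)
  have hd : ∫ ω, (Q ω - W ω) / ν ∂μ ≤ 0 := by
    rw [integral_div, integral_sub hQ.integrable hWp.integrable, hc]
    exact div_nonpos_of_nonpos_of_nonneg (by linarith [hQ.average_le]) hν.le
  have hint : ∫ ω, (Real.log (1 + W ω * g ω) + (Q ω - W ω) / ν) ∂μ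
      = logValue μ g W + ∫ ω, (Q ω - W ω) / ν ∂μ := integral_add i1 i3
  have hmono := integral_mono_ae i2 (i1.add i3) hle
  have hmono' : logValue μ g Q ≤ logValue μ g W + ∫ ω, (Q ω - W ω) / ν ∂μ := by
    rw [← hint]; exact hmono
  refine ⟨by linarith, fun h => ?_⟩
  have heq := (integral_eq_iff_of_ae_le i2 (i1.add i3) hle).1
    (le_antisymm hmono (by
      change ∫ ω, (Real.log (1 + W ω * g ω) + (Q ω - W ω) / ν) ∂μ ≤ logValue μ g Q
      rw [hint]; linarith))
  filter_upwards [heq, hg.pos] with ω h1 h2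
  exact eq_waterfill_of_log_eq hν h2 (hQ.nonneg ω) h1.ge

lemma isBestResponse_waterfill [IsFiniteMeasure μ] {ν : ℝ} (hν : 0 < ν) (hg : IsGain μ g)
    (hc : ∫ ω, waterfill ν (g ω) ∂μ = c) :
    IsBestResponse μ c g fun ω => waterfill ν (g ω) :=
  ⟨isPolicy_waterfill hg hc, fun _ hQ => (logValue_le_waterfill_add hν hg hc hQ).1⟩

lemma exists_le_setIntegral_waterfill [IsFiniteMeasure μ] (hg : IsGain μ g) {A : Set Ω}
    (hA : MeasurableSet A) (hμA : μ A ≠ 0) (c : ℝ) :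
    ∃ ν, c ≤ ∫ ω in A, waterfill ν (g ω) ∂μ := by
  -- Gains may be arbitrarily small on $A$, so a non-null part on which $g$ exceeds some $1/(k+1)$
  -- is isolated. There the inverse gain is at most $k+1$, and the level $c/\mu(B)+k+1$ spends at
  -- least $c/\mu(B)$ in each state.
  have hU : μ (⋃ k : ℕ, A ∩ {ω | 1 / ((k : ℝ) + 1) < g ω}) ≠ 0 := by
    intro h0
    apply hμA
    refine measure_mono_null_ae ?_ h0
    filter_upwards [hg.pos] with ω hω hωA
    obtain ⟨k, hk⟩ := exists_nat_one_div_lt hω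
    exact Set.mem_iUnion.2 ⟨k, hωA, hk⟩
  obtain ⟨k, hk⟩ : ∃ k : ℕ, μ (A ∩ {ω | 1 / ((k : ℝ) + 1) < g ω}) ≠ 0 := by
    by_contra! h
    exact hU (measure_iUnion_null h)
  set B := A ∩ {ω | 1 / ((k : ℝ) + 1) < g ω} with hB
  have hBm : MeasurableSet B := hA.inter (measurableSet_lt measurable_const hg.measurable)
  have hpos : 0 < μ.real B := ENNReal.toReal_pos hk (measure_ne_top _ _)
  refine ⟨c / μ.real B + (k + 1), ?_⟩
  set ν := c / μ.real B + (k + 1) with hν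
  have hi := (integrable_waterfill ν hg).integrableOn (s := A)
  calc c = ∫ _ω in B, (c / μ.real B) ∂μ := by
        rw [setIntegral_const, smul_eq_mul]; field_simp
    _ ≤ ∫ ω in B, waterfill ν (g ω) ∂μ := by
        refine setIntegral_mono_on (integrable_const _) (hi.mono_set Set.inter_subset_left) hBm ?_
        intro ω hω
        have h1 : 1 / ((k : ℝ) + 1) < g ω := hω.2
        have h2 : (g ω)⁻¹ ≤ k + 1 := by
          have := inv_anti₀ (by positivity) h1.le
          simpa using this
        exact le_max_of_le_left (by rw [hν]; linarith)
    _ ≤ ∫ ω in A, waterfill ν (g ω) ∂μ :=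
        setIntegral_mono_set hi (Filter.Eventually.of_forall fun _ => waterfill_nonneg _ _)
          (Set.inter_subset_left.eventuallyLE)

lemma exists_le_integral_waterfill [IsProbabilityMeasure μ] (hg : IsGain μ g) (c : ℝ) :
    ∃ ν, c ≤ ∫ ω, waterfill ν (g ω) ∂μ := by
  simpa using exists_le_setIntegral_waterfill hg MeasurableSet.univ (by simp) c

lemma continuous_integral_waterfill [IsFiniteMeasure μ] (hg : IsGain μ g) :
    Continuous fun ν => ∫ ω, waterfill ν (g ω) ∂μ := by
  rw [continuous_iff_continuousAt]
  intro ν₀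
  refine continuousAt_of_dominated (bound := fun _ => |ν₀| + 1)
    (Filter.Eventually.of_forall fun ν => (integrable_waterfill ν hg).aestronglyMeasurable) ?_
    (integrable_const _) (Filter.Eventually.of_forall fun ω => ?_)
  · filter_upwards [Metric.ball_mem_nhds ν₀ one_pos] with ν hν
    refine Filter.Eventually.of_forall fun ω => ?_
    rw [Real.norm_eq_abs, abs_of_nonneg (waterfill_nonneg _ _)]
    refine (waterfill_le_abs (hg.nonneg ω)).trans ?_
    have : |ν - ν₀| < 1 := hν
    have := abs_sub_abs_le_abs_sub ν ν₀
    linarith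
  · unfold waterfill
    fun_prop

lemma integral_waterfill_of_nonpos (hg : IsGain μ g) {ν : ℝ} (hν : ν ≤ 0) :
    ∫ ω, waterfill ν (g ω) ∂μ = 0 := by
  simp [fun ω => waterfill_of_nonpos hν (hg.nonneg ω)]

lemma exists_integral_waterfill_eq [IsProbabilityMeasure μ] (hg : IsGain μ g) (hc : 0 < c) :
    ∃ ν, 0 < ν ∧ ∫ ω, waterfill ν (g ω) ∂μ = c := by
  obtain ⟨ν₁, h₁⟩ := exists_le_integral_waterfill hg c
  have h0 := integral_waterfill_of_nonpos hg (le_refl (0 : ℝ))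
  obtain ⟨ν, hν⟩ := mem_range_of_exists_le_of_exists_ge (continuous_integral_waterfill hg)
    ⟨0, by rw [h0]; exact hc.le⟩ ⟨ν₁, h₁⟩
  refine ⟨ν, ?_, hν⟩
  by_contra hle
  have := integral_waterfill_of_nonpos hg (not_lt.1 hle)
  simp only at hν
  linarith

lemma IsBestResponse.exists_eq_waterfill [IsProbabilityMeasure μ] (hg : IsGain μ g) (hc : 0 < c)
    (hP : IsBestResponse μ c g P) :
    ∃ ν, 0 < ν ∧ (P =ᵐ[μ] fun ω => waterfill ν (g ω)) ∧ ∫ ω, P ω ∂μ = c := by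
  obtain ⟨ν, hν, h⟩ := exists_integral_waterfill_eq hg hc
  have hW := (logValue_le_waterfill_add hν hg h hP.isPolicy).2
    (hP.le _ (isPolicy_waterfill hg h))
  exact ⟨ν, hν, hW, by rw [integral_congr_ae hW, h]⟩

lemma IsBestResponse.ae_eq_of_le [IsProbabilityMeasure μ] (hg : IsGain μ g) (hc : 0 < c)
    (hP : IsBestResponse μ c g P) (hQ : IsPolicy μ c Q)
    (h : logValue μ g P ≤ logValue μ g Q) : Q =ᵐ[μ] P := by
  obtain ⟨ν, hν, hPν, hi⟩ := hP.exists_eq_waterfill hg hc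
  rw [integral_congr_ae hPν] at hi
  rw [logValue_congr_policy hPν] at h
  exact ((logValue_le_waterfill_add hν hg hi hQ).2 h).trans hPν.symm

lemma IsBestResponse.congr_gain {g' : Ω → ℝ} (hP : IsBestResponse μ c g P) (h : g =ᵐ[μ] g') :
    IsBestResponse μ c g' P :=
  ⟨hP.isPolicy, fun Q hQ => by
    rw [← logValue_congr_gain h, ← logValue_congr_gain h]; exact hP.le Q hQ⟩

end FadingMAC

/-! ### Equilibria as pairs of water levels -/

namespace FadingMAC

/-- The least point of a "supersolution" set of two functions, each increasing in its own variable
and decreasing in the other one, is a solution of both equations. -/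
lemma exists_least_level_pair {F G : ℝ × ℝ → ℝ} (hF : Continuous F) (hG : Continuous G)
    (hFy : ∀ x, Antitone fun y => F (x, y)) (hGx : ∀ y, Antitone fun x => G (x, y))
    {c₁ c₂ : ℝ} (hF0 : ∀ x y, c₁ ≤ F (x, y) → 0 < x) (hG0 : ∀ x y, c₂ ≤ G (x, y) → 0 < y)
    (hne : ∃ z, c₁ ≤ F z ∧ c₂ ≤ G z) :
    ∃ x y, 0 < x ∧ 0 < y ∧ F (x, y) = c₁ ∧ G (x, y) = c₂ ∧
      ∀ x' y', c₁ ≤ F (x', y') → c₂ ≤ G (x', y') → x ≤ x' ∧ y ≤ y' := by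
  set S : Set (ℝ × ℝ) := {z | c₁ ≤ F z ∧ c₂ ≤ G z} with hS
  have hSc : IsClosed S := (isClosed_le continuous_const hF).inter (isClosed_le continuous_const hG)
  -- For each constraint, keep the point that supplies the minimum in the function's own variable;
  -- lowering the other variable can only raise the function.
  have hinf : ∀ z ∈ S, ∀ w ∈ S, (min z.1 w.1, min z.2 w.2) ∈ S := by
    rintro ⟨z₁, z₂⟩ hz ⟨w₁, w₂⟩ hw
    constructor
    · change c₁ ≤ F (min z₁ w₁, min z₂ w₂)
      rcases min_choice z₁ w₁ with h | h <;> rw [h]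
      · exact hz.1.trans (hFy z₁ (min_le_left _ _))
      · exact hw.1.trans (hFy w₁ (min_le_right _ _))
    · change c₂ ≤ G (min z₁ w₁, min z₂ w₂)
      rcases min_choice z₂ w₂ with h | h <;> rw [h]
      · exact hz.2.trans (hGx z₂ (min_le_left _ _))
      · exact hw.2.trans (hGx w₂ (min_le_right _ _))
  have hb1 : BddBelow (Prod.fst '' S) :=
    ⟨0, by rintro _ ⟨z, hz, rfl⟩; exact (hF0 z.1 z.2 hz.1).le⟩
  have hb2 : BddBelow (Prod.snd '' S) :=
    ⟨0, by rintro _ ⟨z, hz, rfl⟩; exact (hG0 z.1 z.2 hz.2).le⟩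
  have hne1 : (Prod.fst '' S).Nonempty := Set.Nonempty.image _ hne
  have hne2 : (Prod.snd '' S).Nonempty := Set.Nonempty.image _ hne
  set x := sInf (Prod.fst '' S) with hx
  set y := sInf (Prod.snd '' S) with hy
  have hlow : ∀ z ∈ S, x ≤ z.1 ∧ y ≤ z.2 := fun z hz =>
    ⟨csInf_le hb1 ⟨z, hz, rfl⟩, csInf_le hb2 ⟨z, hz, rfl⟩⟩
  have hmem : (x, y) ∈ S := by
    rw [← hSc.closure_eq, Metric.mem_closure_iff]
    intro ε hε
    obtain ⟨_, ⟨z, hz, rfl⟩, hz'⟩ := exists_lt_of_csInf_lt hne1 (show x < x + ε by linarith)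
    obtain ⟨_, ⟨w, hw, rfl⟩, hw'⟩ := exists_lt_of_csInf_lt hne2 (show y < y + ε by linarith)
    refine ⟨_, hinf z hz w hw, ?_⟩
    have hm := hlow _ (hinf z hz w hw)
    have h1 := min_le_left z.1 w.1
    have h2 := min_le_right z.2 w.2
    rw [Prod.dist_eq, max_lt_iff, Real.dist_eq, Real.dist_eq, abs_lt, abs_lt]
    dsimp only at hm ⊢
    refine ⟨⟨by linarith, by linarith⟩, ⟨by linarith, by linarith⟩⟩
  refine ⟨x, y, hF0 x y hmem.1, hG0 x y hmem.2, ?_, ?_, fun x' y' h1 h2 => hlow (x', y') ⟨h1, h2⟩⟩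
  -- With slack in the first constraint, $x$ could be lowered slightly by continuity; this does not
  -- hurt the second constraint, so $x$ would not be least.
  · refine le_antisymm (not_lt.1 fun hlt => ?_) hmem.1
    have hcont : ContinuousAt (fun t => F (t, y)) x := (by fun_prop : Continuous _).continuousAt
    obtain ⟨t, ht, htx⟩ := ((hcont.eventually (lt_mem_nhds hlt)).filter_mono
      (nhdsWithin_le_nhds (s := Set.Iio x))).and self_mem_nhdsWithin |>.exists
    exact absurd (hlow (t, y) ⟨ht.le, hmem.2.trans (hGx y (le_of_lt htx))⟩).1 (not_le.2 htx)
  · refine le_antisymm (not_lt.1 fun hlt => ?_) hmem.2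
    have hcont : ContinuousAt (fun t => G (x, t)) y := (by fun_prop : Continuous _).continuousAt
    obtain ⟨t, ht, hty⟩ := ((hcont.eventually (lt_mem_nhds hlt)).filter_mono
      (nhdsWithin_le_nhds (s := Set.Iio y))).and self_mem_nhdsWithin |>.exists
    exact absurd (hlow (x, t) ⟨hmem.1.trans (hFy x (le_of_lt hty)), ht.le⟩).2 (not_le.2 hty)

/-- The effective gain of a user with gain `a` when the other user, with gain `b`, transmits at
power `q`; `d` is the Gram determinant of the two channels. -/
noncomputable def gain (a b d q : ℝ) : ℝ := (a + q * d) / (1 + q * b)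

lemma gain_zero (a b d : ℝ) : gain a b d 0 = a := by simp [gain]

section gain

variable {a b d q q' : ℝ}

lemma gain_nonneg (ha : 0 ≤ a) (hb : 0 ≤ b) (hd : 0 ≤ d) (hq : 0 ≤ q) : 0 ≤ gain a b d q := by
  unfold gain; positivity

lemma gain_pos (ha : 0 < a) (hb : 0 ≤ b) (hd : 0 ≤ d) (hq : 0 ≤ q) : 0 < gain a b d q := by
  unfold gain; positivity

lemma gain_antitone (hb : 0 ≤ b) (hd : d ≤ a * b) (hq : 0 ≤ q) (h : q ≤ q') :
    gain a b d q' ≤ gain a b d q := by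
  have : 0 ≤ q' := hq.trans h
  unfold gain
  rw [div_le_div_iff₀ (by positivity) (by positivity)]
  nlinarith [mul_nonneg (sub_nonneg.2 h) (sub_nonneg.2 hd)]

lemma gain_le (hb : 0 ≤ b) (hd : d ≤ a * b) (hq : 0 ≤ q) : gain a b d q ≤ a := by
  simpa [gain_zero] using gain_antitone hb hd le_rfl hq

lemma one_add_mul_one_add_gain (p : ℝ) (hb : 0 ≤ b) (hq : 0 ≤ q) :
    (1 + q * b) * (1 + p * gain a b d q) = 1 + p * a + q * b + p * q * d := by
  unfold gain; field_simp; ring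

end gain

lemma indicator_nonneg' {Ω : Type*} {D : Set Ω} {P : Ω → ℝ} (h : ∀ ω, 0 ≤ P ω)
    (ω : Ω) :
    0 ≤ D.indicator P ω := Set.indicator_nonneg (fun ω _ => h ω) ω

variable {Ω : Type*} [MeasurableSpace Ω]

/-- The gains `a`, `b` of the two users and the Gram determinant `d` of their channels. -/
structure IsGainPair (μ : Measure Ω) (a b d : Ω → ℝ) : Prop where
  fst : IsGain μ a
  snd : IsGain μ b
  measurable_gram : Measurable d
  gram_nonneg : ∀ ω, 0 ≤ d ω
  gram_le : ∀ ω, d ω ≤ a ω * b ω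

lemma IsGainPair.swap {μ : Measure Ω} {a b d : Ω → ℝ} (h : IsGainPair μ a b d) :
    IsGainPair μ b a d :=
  ⟨h.snd, h.fst, h.measurable_gram, h.gram_nonneg, fun ω => by rw [mul_comm]; exact h.gram_le ω⟩

/-- The effective gain of the user with gain `a` over fading states, when the other user uses
policy `P`. -/
noncomputable def gainUnder (a b d P : Ω → ℝ) : Ω → ℝ := fun ω => gain (a ω) (b ω) (d ω) (P ω)

section

variable {μ : Measure Ω} {a b d : Ω → ℝ} {P : Ω → ℝ}

lemma IsGainPair.isGain_gainUnder (h : IsGainPair μ a b d) (hm : Measurable P)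
    (hP : ∀ ω, 0 ≤ P ω) : IsGain μ (gainUnder a b d P) := by
  have hmeas : Measurable (gainUnder a b d P) :=
    (h.fst.measurable.add (hm.mul h.measurable_gram)).div
      ((hm.mul h.snd.measurable).const_add 1)
  have hnn : ∀ ω, 0 ≤ gainUnder a b d P ω := fun ω =>
    gain_nonneg (h.fst.nonneg ω) (h.snd.nonneg ω) (h.gram_nonneg ω) (hP ω)
  refine ⟨hmeas, hnn, ?_, ?_⟩
  · filter_upwards [h.fst.pos] with ω hω
    exact gain_pos hω (h.snd.nonneg ω) (h.gram_nonneg ω) (hP ω)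
  · refine h.fst.integrable_log.mono' (hmeas.const_add 1).log.aestronglyMeasurable
      (Filter.Eventually.of_forall fun ω => ?_)
    rw [Real.norm_eq_abs, abs_of_nonneg (log_one_add_nonneg (hnn ω))]
    have := hnn ω
    exact Real.log_le_log (by positivity)
      (by have := gain_le (h.snd.nonneg ω) (h.gram_le ω) (hP ω); unfold gainUnder; linarith)

lemma IsGainPair.isGain_indicator (h : IsGainPair μ a b d) {D : Set Ω} (hD : MeasurableSet D)
    (hm : Measurable P) (hP : ∀ ω, 0 ≤ P ω) : IsGain μ (gainUnder a b d (D.indicator P)) :=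
  h.isGain_gainUnder (hm.indicator hD) (indicator_nonneg' hP)

/-- Equilibria of the water-filling game in which user 1 suffers interference on `D` and user 2
on the complement. -/
structure IsEquilibrium (μ : Measure Ω) (a b d : Ω → ℝ) (c₁ c₂ : ℝ) (D : Set Ω)
    (P₁ P₂ : Ω → ℝ) : Prop where
  best₁ : IsBestResponse μ c₁ (gainUnder a b d (D.indicator P₂)) P₁
  best₂ : IsBestResponse μ c₂ (gainUnder b a d (Dᶜ.indicator P₁)) P₂

lemma IsEquilibrium.swap {c₁ c₂ : ℝ} {D : Set Ω} {P₁ P₂ : Ω → ℝ}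
    (h : IsEquilibrium μ a b d c₁ c₂ D P₁ P₂) : IsEquilibrium μ b a d c₂ c₁ Dᶜ P₂ P₁ :=
  ⟨h.best₂, by rw [compl_compl]; exact h.best₁⟩

/-- Average power of the user with gain `a` at water level `z.1`, against interference on `D` by
water-filling of the other user at level `z.2`. -/
noncomputable def averagePower (μ : Measure Ω) (a b d : Ω → ℝ) (D : Set Ω) (z : ℝ × ℝ) : ℝ :=
  ∫ ω, waterfill z.1 (gainUnder a b d (D.indicator fun ω => waterfill z.2 (b ω)) ω) ∂μ

lemma IsGainPair.isGain_waterfill (h : IsGainPair μ a b d) {D : Set Ω} (hD : MeasurableSet D)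
    (y : ℝ) : IsGain μ (gainUnder a b d (D.indicator fun ω => waterfill y (b ω))) :=
  h.isGain_indicator hD (measurable_waterfill y h.snd.measurable) fun _ => waterfill_nonneg _ _

lemma gainUnder_antitone_ae (h : IsGainPair μ a b d) {P Q : Ω → ℝ} (hP : ∀ ω, 0 ≤ P ω)
    (hPQ : P ≤ᵐ[μ] Q) : gainUnder a b d Q ≤ᵐ[μ] gainUnder a b d P := by
  filter_upwards [hPQ] with ω hω
  exact gain_antitone (h.snd.nonneg ω) (h.gram_le ω) (hP ω) hω

lemma averagePower_antitone_right [IsFiniteMeasure μ] (h : IsGainPair μ a b d) {D : Set Ω}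
    (hD : MeasurableSet D) (x : ℝ) : Antitone fun y => averagePower μ a b d D (x, y) := by
  intro y y' hy
  refine integral_mono_ae (integrable_waterfill x (h.isGain_waterfill hD y'))
    (integrable_waterfill x (h.isGain_waterfill hD y)) ?_
  have hle := gainUnder_antitone_ae h (P := D.indicator fun ω => waterfill y (b ω))
    (Q := D.indicator fun ω => waterfill y' (b ω))
    (indicator_nonneg' fun ω => waterfill_nonneg _ _)
    (Filter.Eventually.of_forall fun ω => Set.indicator_le_indicator (waterfill_mono_level hy _))
  filter_upwards [hle, (h.isGain_waterfill hD y').pos] with ω h1 h2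
  exact waterfill_mono_gain x h2 h1

lemma continuous_averagePower [IsFiniteMeasure μ] (h : IsGainPair μ a b d) {D : Set Ω}
    (hD : MeasurableSet D) : Continuous (averagePower μ a b d D) := by
  rw [continuous_iff_continuousAt]
  intro z₀
  refine continuousAt_of_dominated (bound := fun _ => |z₀.1| + 1)
    (Filter.Eventually.of_forall fun z =>
      (integrable_waterfill z.1 (h.isGain_waterfill hD z.2)).aestronglyMeasurable) ?_
    (integrable_const _) ?_
  · filter_upwards [Metric.ball_mem_nhds z₀ one_pos] with z hz
    refine Filter.Eventually.of_forall fun ω => ?_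
    rw [Real.norm_eq_abs, abs_of_nonneg (waterfill_nonneg _ _)]
    refine (waterfill_le_abs ((h.isGain_waterfill hD z.2).nonneg ω)).trans ?_
    have hz' : dist z z₀ < 1 := hz
    have h1 : |z.1 - z₀.1| < 1 := (le_max_left _ _).trans_lt (by rwa [Prod.dist_eq] at hz')
    have := abs_sub_abs_le_abs_sub z.1 z₀.1
    linarith
  · filter_upwards [h.fst.pos] with ω hω
    have hb := h.snd.nonneg ω
    have hd := h.gram_nonneg ω
    have hcont : Continuous fun z : ℝ × ℝ => D.indicator (fun ω => waterfill z.2 (b ω)) ω := by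
      by_cases hωD : ω ∈ D
      · simp only [Set.indicator_of_mem hωD, waterfill]; fun_prop
      · simp only [Set.indicator_of_notMem hωD]; fun_prop
    have hnn : ∀ z : ℝ × ℝ, 0 ≤ D.indicator (fun ω => waterfill z.2 (b ω)) ω :=
      fun z => indicator_nonneg' (fun ω => waterfill_nonneg _ _) ω
    have hg : Continuous fun z : ℝ × ℝ =>
        gainUnder a b d (D.indicator fun ω => waterfill z.2 (b ω)) ω := by
      unfold gainUnder gain
      refine Continuous.div (by fun_prop) (by fun_prop) fun z => ?_
      have := hnn z
      positivity
    have hg' := hg.inv₀ fun z => (gain_pos hω hb hd (hnn z)).ne'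
    exact ((continuous_fst.sub hg').max continuous_const).continuousAt

lemma averagePower_of_nonpos (h : IsGainPair μ a b d) {D : Set Ω}
    (hD : MeasurableSet D) {x : ℝ} (hx : x ≤ 0) (y : ℝ) : averagePower μ a b d D (x, y) = 0 :=
  integral_waterfill_of_nonpos (h.isGain_waterfill hD y) hx

/-- On $D$ user 2 sees no interference, so $y$ can be chosen to spend $c_2$ on $D$ alone, whatever
$x$ is. Then $x$ is chosen against the interference at that $y$. -/
lemma exists_averagePower_ge [IsProbabilityMeasure μ] (h : IsGainPair μ a b d) {D : Set Ω}
    (hD : MeasurableSet D) (c₁ c₂ : ℝ) (hμ : μ D ≠ 0) :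
    ∃ x y, c₁ ≤ averagePower μ a b d D (x, y) ∧ c₂ ≤ averagePower μ b a d Dᶜ (y, x) := by
  obtain ⟨y, hy⟩ := exists_le_setIntegral_waterfill h.snd hD hμ c₂
  obtain ⟨x, hx⟩ := exists_le_integral_waterfill (h.isGain_waterfill hD y) c₁
  refine ⟨x, y, hx, hy.trans ?_⟩
  have hg := h.swap.isGain_waterfill hD.compl x
  refine le_trans (le_of_eq (setIntegral_congr_fun hD fun ω hω => ?_))
    (setIntegral_le_integral (integrable_waterfill y hg)
      (Filter.Eventually.of_forall fun _ => waterfill_nonneg _ _))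
  have : ω ∉ Dᶜ := fun h' => h' hω
  simp [gainUnder, gain_zero, hω]

/-- This decouples the game: on the set where a user interferes, it is itself free of interference,
so the interference it causes is plain water-filling over its own gain. -/
lemma indicator_waterfill_of_eq {D : Set Ω} {P Q : Ω → ℝ} {y : ℝ}
    (h : P =ᵐ[μ] fun ω => waterfill y (gainUnder b a d (Dᶜ.indicator Q) ω)) :
    D.indicator P =ᵐ[μ] D.indicator fun ω => waterfill y (b ω) := by
  filter_upwards [h] with ω hω
  by_cases hωD : ω ∈ D
  · simp [hωD, hω, gainUnder, gain_zero]
  · simp [hωD]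

lemma gainUnder_congr {P Q : Ω → ℝ} (h : P =ᵐ[μ] Q) :
    gainUnder a b d P =ᵐ[μ] gainUnder a b d Q := by
  filter_upwards [h] with ω hω
  simp [gainUnder, hω]

/-- An equilibrium is given by two water levels. -/
lemma IsEquilibrium.exists_levels [IsProbabilityMeasure μ] (h : IsGainPair μ a b d) {D : Set Ω}
    (hD : MeasurableSet D) {c₁ c₂ : ℝ} (hc₁ : 0 < c₁) (hc₂ : 0 < c₂) {P₁ P₂ : Ω → ℝ}
    (hP : IsEquilibrium μ a b d c₁ c₂ D P₁ P₂) :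
    ∃ x y, 0 < x ∧ 0 < y ∧ averagePower μ a b d D (x, y) = c₁ ∧
      averagePower μ b a d Dᶜ (y, x) = c₂ ∧
      (P₁ =ᵐ[μ] fun ω => waterfill x (gainUnder a b d (D.indicator P₂) ω)) ∧
      (P₂ =ᵐ[μ] fun ω => waterfill y (gainUnder b a d (Dᶜ.indicator P₁) ω)) := by
  obtain ⟨x, hx, h1, hi1⟩ := hP.best₁.exists_eq_waterfill (h.isGain_indicator hD
    hP.best₂.isPolicy.measurable hP.best₂.isPolicy.nonneg) hc₁
  obtain ⟨y, hy, h2, hi2⟩ := hP.best₂.exists_eq_waterfill (h.swap.isGain_indicator hD.compl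
    hP.best₁.isPolicy.measurable hP.best₁.isPolicy.nonneg) hc₂
  have h3 : D.indicator P₂ =ᵐ[μ] D.indicator fun ω => waterfill y (b ω) :=
    indicator_waterfill_of_eq h2
  have h4 : Dᶜ.indicator P₁ =ᵐ[μ] Dᶜ.indicator fun ω => waterfill x (a ω) := by
    refine indicator_waterfill_of_eq (b := a) (a := b) (d := d) (Q := P₂) ?_
    rw [compl_compl]; exact h1
  refine ⟨x, y, hx, hy, ?_, ?_, h1, h2⟩
  · rw [← hi1]
    refine integral_congr_ae ?_
    filter_upwards [h1, gainUnder_congr (a := a) (b := b) (d := d) h3] with ω e1 e2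
    rw [e1, e2]
  · rw [← hi2]
    refine integral_congr_ae ?_
    filter_upwards [h2, gainUnder_congr (a := b) (b := a) (d := d) h4] with ω e1 e2
    rw [e1, e2]

/-- There is an equilibrium at which both users interfere least. -/
theorem exists_least_equilibrium [IsProbabilityMeasure μ] (h : IsGainPair μ a b d) {D : Set Ω}
    (hD : MeasurableSet D) {c₁ c₂ : ℝ} (hc₁ : 0 < c₁) (hc₂ : 0 < c₂) :
    ∃ P₁ P₂, IsEquilibrium μ a b d c₁ c₂ D P₁ P₂ ∧
      ∀ Q₁ Q₂, IsEquilibrium μ a b d c₁ c₂ D Q₁ Q₂ →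
        D.indicator P₂ ≤ᵐ[μ] D.indicator Q₂ ∧ Dᶜ.indicator P₁ ≤ᵐ[μ] Dᶜ.indicator Q₁ := by
  obtain ⟨x, y, hx, hy, hF, hG, hleast⟩ := exists_least_level_pair
    (F := averagePower μ a b d D) (G := fun z => averagePower μ b a d Dᶜ z.swap)
    (c₁ := c₁) (c₂ := c₂)
    (continuous_averagePower h hD) ((continuous_averagePower h.swap hD.compl).comp continuous_swap)
    (averagePower_antitone_right h hD) (averagePower_antitone_right h.swap hD.compl)
    (fun x y hxy => not_le.1 fun hx => by
      rw [averagePower_of_nonpos h hD hx] at hxy; linarith)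
    (fun x y hxy => not_le.1 fun hy => by
      simp only [Prod.swap_prod_mk] at hxy
      rw [averagePower_of_nonpos h.swap hD.compl hy] at hxy; linarith)
    (by
      -- A feasible pair of levels is built from whichever of $D$ and $D^c$ is not null.
      by_cases hμ : μ D = 0
      · have hμ' : μ Dᶜ ≠ 0 := by
          intro h0
          have := measure_univ_le_add_compl (μ := μ) D
          simp [hμ, h0] at this
        obtain ⟨y, x, h1, h2⟩ := exists_averagePower_ge h.swap hD.compl c₂ c₁ hμ'
        rw [compl_compl] at h2
        exact ⟨(x, y), h2, h1⟩
      · obtain ⟨x, y, h1, h2⟩ := exists_averagePower_ge h hD c₁ c₂ hμ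
        exact ⟨(x, y), h1, h2⟩)
  -- Each policy answers plain water-filling of the opponent at the least levels. By `e1` and `e2`
  -- this opponent causes the same interference as the actual policy, which makes the pair an
  -- equilibrium.
  set P₁ := fun ω => waterfill x (gainUnder a b d (D.indicator fun ω => waterfill y (b ω)) ω)
    with hP₁
  set P₂ := fun ω => waterfill y (gainUnder b a d (Dᶜ.indicator fun ω => waterfill x (a ω)) ω)
    with hP₂
  have e2 : D.indicator P₂ =ᵐ[μ] D.indicator fun ω => waterfill y (b ω) :=
    indicator_waterfill_of_eq Filter.EventuallyEq.rfl
  have e1 : Dᶜ.indicator P₁ =ᵐ[μ] Dᶜ.indicator fun ω => waterfill x (a ω) := by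
    refine indicator_waterfill_of_eq (b := a) (a := b) (d := d)
      (Q := fun ω => waterfill y (b ω)) ?_
    rw [compl_compl]
  refine ⟨P₁, P₂, ⟨?_, ?_⟩, fun Q₁ Q₂ hQ => ?_⟩
  · exact (isBestResponse_waterfill hx (h.isGain_waterfill hD y) hF).congr_gain
      (gainUnder_congr e2.symm)
  · exact (isBestResponse_waterfill hy (h.swap.isGain_waterfill hD.compl x) hG).congr_gain
      (gainUnder_congr e1.symm)
  · obtain ⟨x', y', -, -, hx', hy', h1, h2⟩ := hQ.exists_levels h hD hc₁ hc₂
    obtain ⟨hxx, hyy⟩ := hleast x' y' hx'.ge hy'.ge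
    have f2 : D.indicator Q₂ =ᵐ[μ] D.indicator fun ω => waterfill y' (b ω) :=
      indicator_waterfill_of_eq h2
    have f1 : Dᶜ.indicator Q₁ =ᵐ[μ] Dᶜ.indicator fun ω => waterfill x' (a ω) := by
      refine indicator_waterfill_of_eq (b := a) (a := b) (d := d) (Q := Q₂) ?_
      rw [compl_compl]; exact h1
    constructor
    · filter_upwards [e2, f2] with ω e f
      rw [e, f]
      exact Set.indicator_le_indicator (waterfill_mono_level hyy _)
    · filter_upwards [e1, f1] with ω e f
      rw [e, f]
      exact Set.indicator_le_indicator (waterfill_mono_level hxx _)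

/-- There is an equilibrium that dominates every other one, strictly unless they agree. -/
theorem exists_dominating_equilibrium [IsProbabilityMeasure μ] (h : IsGainPair μ a b d)
    {D : Set Ω} (hD : MeasurableSet D) {c₁ c₂ : ℝ} (hc₁ : 0 < c₁) (hc₂ : 0 < c₂) :
    ∃ P₁ P₂, IsEquilibrium μ a b d c₁ c₂ D P₁ P₂ ∧
      ∀ Q₁ Q₂, IsEquilibrium μ a b d c₁ c₂ D Q₁ Q₂ →
        logValue μ (gainUnder a b d (D.indicator Q₂)) Q₁
            ≤ logValue μ (gainUnder a b d (D.indicator P₂)) P₁ ∧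
        logValue μ (gainUnder b a d (Dᶜ.indicator Q₁)) Q₂
            ≤ logValue μ (gainUnder b a d (Dᶜ.indicator P₁)) P₂ ∧
        (logValue μ (gainUnder a b d (D.indicator P₂)) P₁
            ≤ logValue μ (gainUnder a b d (D.indicator Q₂)) Q₁ → Q₁ =ᵐ[μ] P₁) ∧
        (logValue μ (gainUnder b a d (Dᶜ.indicator P₁)) P₂
            ≤ logValue μ (gainUnder b a d (Dᶜ.indicator Q₁)) Q₂ → Q₂ =ᵐ[μ] P₂) := by
  obtain ⟨P₁, P₂, hP, hleast⟩ := exists_least_equilibrium h hD hc₁ hc₂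
  refine ⟨P₁, P₂, hP, fun Q₁ Q₂ hQ => ?_⟩
  obtain ⟨hl2, hl1⟩ := hleast Q₁ Q₂ hQ
  have p1 := hP.best₁.isPolicy
  have p2 := hP.best₂.isPolicy
  have q1 := hQ.best₁.isPolicy
  have q2 := hQ.best₂.isPolicy
  have gP1 := h.isGain_indicator hD p2.measurable p2.nonneg
  have gQ1 := h.isGain_indicator hD q2.measurable q2.nonneg
  have gP2 := h.swap.isGain_indicator hD.compl p1.measurable p1.nonneg
  have gQ2 := h.swap.isGain_indicator hD.compl q1.measurable q1.nonneg
  -- Passing from the interference of $Q_2$ to the smaller one of $P_2$ helps $Q_1$, and $P_1$ does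
  -- at least as well there. If the values tie, $Q_1$ is also optimal against $P_2$ and equals $P_1$
  -- by uniqueness.
  have m1 := logValue_mono_gain gQ1 gP1
    (gainUnder_antitone_ae h (indicator_nonneg' p2.nonneg) hl2) q1
  have m2 := logValue_mono_gain gQ2 gP2
    (gainUnder_antitone_ae h.swap (indicator_nonneg' p1.nonneg) hl1) q2
  exact ⟨m1.trans (hP.best₁.le _ q1), m2.trans (hP.best₂.le _ q2),
    fun hle => hP.best₁.ae_eq_of_le gP1 hc₁ q1 (hle.trans m1),
    fun hle => hP.best₂.ae_eq_of_le gP2 hc₂ q2 (hle.trans m2)⟩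

end

end FadingMAC

/-! ### Almost sure convergence from convexity -/

namespace FadingMAC

open Filter Topology

variable {Ω : Type*} [MeasurableSpace Ω] {μ : Measure Ω}

/-- Fatou's lemma for nonnegative real functions with bounded integrals. -/
lemma integrable_and_integral_le_of_tendsto {f : ℕ → Ω → ℝ} {g : Ω → ℝ} {c : ℕ → ℝ} {l : ℝ}
    (hf : ∀ k, Integrable (f k) μ) (hf0 : ∀ k ω, 0 ≤ f k ω) (hg : Measurable g)
    (hfg : ∀ᵐ ω ∂μ, Tendsto (fun k => f k ω) atTop (𝓝 (g ω)))
    (hc : ∀ k, ∫ ω, f k ω ∂μ ≤ c k) (hcl : Tendsto c atTop (𝓝 l)) :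
    Integrable g μ ∧ ∫ ω, g ω ∂μ ≤ l := by
  have hg0 : 0 ≤ᵐ[μ] g := by
    filter_upwards [hfg] with ω hω
    exact ge_of_tendsto' hω fun k => hf0 k ω
  have hl0 : 0 ≤ l := ge_of_tendsto' hcl fun k => (integral_nonneg (hf0 k)).trans (hc k)
  have hlin : ∫⁻ ω, ENNReal.ofReal (g ω) ∂μ ≤ ENNReal.ofReal l := by
    calc ∫⁻ ω, ENNReal.ofReal (g ω) ∂μ
        = ∫⁻ ω, liminf (fun k => ENNReal.ofReal (f k ω)) atTop ∂μ := by
          refine lintegral_congr_ae ?_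
          filter_upwards [hfg] with ω hω
          exact (ENNReal.tendsto_ofReal hω).liminf_eq.symm
      _ ≤ liminf (fun k => ∫⁻ ω, ENNReal.ofReal (f k ω) ∂μ) atTop :=
          lintegral_liminf_le' fun k => (hf k).aemeasurable.ennreal_ofReal
      _ ≤ liminf (fun k => ENNReal.ofReal (c k)) atTop := by
          refine liminf_le_liminf (Eventually.of_forall fun k => ?_)
          rw [← ofReal_integral_eq_lintegral_ofReal (hf k) (Eventually.of_forall (hf0 k))]
          exact ENNReal.ofReal_le_ofReal (hc k)
      _ = ENNReal.ofReal l := (ENNReal.tendsto_ofReal hcl).liminf_eq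
  have hint : Integrable g μ :=
    ⟨hg.aestronglyMeasurable, (hasFiniteIntegral_iff_ofReal hg0).2
      (hlin.trans_lt ENNReal.ofReal_lt_top)⟩
  refine ⟨hint, ?_⟩
  rw [← ofReal_integral_eq_lintegral_ofReal hint hg0] at hlin
  exact (ENNReal.ofReal_le_ofReal_iff hl0).1 hlin

lemma exists_subseq_tendsto_ae_of_cauchy {u : ℕ → Ω → ℝ} (hu : ∀ k, Integrable (u k) μ)
    (hC : ∀ ε > 0, ∃ N, ∀ k ≥ N, ∫ ω, |u k ω - u N ω| ∂μ < ε) :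
    ∃ (v : Ω → ℝ) (φ : ℕ → ℕ), Measurable v ∧ StrictMono φ ∧
      ∀ᵐ ω ∂μ, Tendsto (fun k => u (φ k) ω) atTop (𝓝 (v ω)) := by
  set U : ℕ → Lp ℝ 1 μ := fun k => (hu k).toL1 (u k) with hU
  have hUC : CauchySeq U := by
    rw [Metric.cauchySeq_iff']
    intro ε hε
    obtain ⟨N, hN⟩ := hC ε hε
    refine ⟨N, fun k hk => ?_⟩
    have h1 : dist (U k) (U N) = ∫ ω, |u k ω - u N ω| ∂μ := by
      rw [dist_eq_norm, hU]
      dsimp only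
      rw [← Integrable.toL1_sub, L1.norm_of_fun_eq_integral_norm]
      rfl
    rw [h1]
    exact hN k hk
  obtain ⟨V, hV⟩ := cauchySeq_tendsto_of_complete hUC
  obtain ⟨φ, hφ, hlim⟩ := (tendstoInMeasure_of_tendsto_Lp hV).exists_seq_tendsto_ae
  refine ⟨V, φ, (Lp.stronglyMeasurable V).measurable, hφ, ?_⟩
  have hae : ∀ᵐ ω ∂μ, ∀ k, U k ω = u k ω := ae_all_iff.2 fun k => (hu k).coeFn_toL1
  filter_upwards [hlim, hae] with ω h1 h2
  simpa [h2] using h1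

/-- The concavity gap of the square root controls increments. -/
lemma abs_sqrt_sub_sqrt_le {x y η : ℝ} (hx : 0 ≤ x) (hy : 0 ≤ y) (hη : 0 < η) :
    |√x - √y| ≤ 3 / η * (√((x + y) / 2) - (√x + √y) / 2) + η / 2 * (√x + √y) := by
  set X := √x
  set Y := √y
  set M := √((x + y) / 2)
  have hX : 0 ≤ X := Real.sqrt_nonneg _
  have hY : 0 ≤ Y := Real.sqrt_nonneg _
  have hM : 0 ≤ M := Real.sqrt_nonneg _
  have hM2 : M ^ 2 = (X ^ 2 + Y ^ 2) / 2 := by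
    rw [Real.sq_sqrt hx, Real.sq_sqrt hy, Real.sq_sqrt (by positivity)]
  have hMs : M ≤ X + Y := by
    refine abs_le_of_sq_le_sq' ?_ (by positivity) |>.2
    nlinarith [mul_nonneg hX hY]
  have hG : 0 ≤ M - (X + Y) / 2 := by
    have := (abs_le_of_sq_le_sq' (a := (X + Y) / 2) (b := M)
      (by nlinarith [sq_nonneg (X - Y)]) hM).2
    linarith
  set G := M - (X + Y) / 2 with hGdef
  have h1 : (X - Y) ^ 2 ≤ 6 * (G * (X + Y)) := by
    have : (X - Y) ^ 2 = 4 * (G * (M + (X + Y) / 2)) := by rw [hGdef]; nlinarith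
    nlinarith [mul_le_mul_of_nonneg_left hMs hG]
  -- The arithmetic-geometric mean inequality $4st\le(s+t)^2$ with $s=3G/\eta$ and $t=\eta(X+Y)/2$.
  have h2 : 6 * (G * (X + Y)) ≤ (3 / η * G + η / 2 * (X + Y)) ^ 2 := by
    have h3 : (3 / η * G) * (η / 2 * (X + Y)) = 3 / 2 * (G * (X + Y)) := by field_simp
    nlinarith [sq_nonneg (3 / η * G - η / 2 * (X + Y))]
  exact abs_le_of_sq_le_sq (h1.trans h2) (by positivity)

lemma IsPolicy.integrable_sqrt [IsFiniteMeasure μ] {c : ℝ} {P : Ω → ℝ} (hP : IsPolicy μ c P) :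
    Integrable (fun ω => √(P ω)) μ := by
  refine ((integrable_const 1).add hP.integrable).mono' hP.measurable.sqrt.aestronglyMeasurable
    (Eventually.of_forall fun ω => ?_)
  rw [Real.norm_eq_abs, abs_of_nonneg (Real.sqrt_nonneg _)]
  have h := hP.nonneg ω
  simp only [Pi.add_apply]
  nlinarith [Real.sq_sqrt h, sq_nonneg (√(P ω) - 1), Real.sqrt_nonneg (P ω)]

lemma IsPolicy.integral_sqrt_le [IsProbabilityMeasure μ] {c : ℝ} {P : Ω → ℝ}
    (hP : IsPolicy μ c P) : ∫ ω, √(P ω) ∂μ ≤ 1 + c := by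
  calc ∫ ω, √(P ω) ∂μ ≤ ∫ ω, (1 + P ω) ∂μ := by
        refine integral_mono hP.integrable_sqrt ((integrable_const 1).add hP.integrable) fun ω => ?_
        have h := hP.nonneg ω
        dsimp only
        nlinarith [Real.sq_sqrt h, sq_nonneg (√(P ω) - 1), Real.sqrt_nonneg (P ω)]
    _ = 1 + ∫ ω, P ω ∂μ := by
        rw [integral_add (integrable_const 1) hP.integrable]; simp
    _ ≤ 1 + c := by linarith [hP.average_le]

/-- The midpoint of two policies. -/
noncomputable def midPolicy (P Q : Ω → ℝ) : Ω → ℝ := fun ω => (P ω + Q ω) / 2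

lemma IsPolicy.mid {c : ℝ} {P Q : Ω → ℝ} (hP : IsPolicy μ c P) (hQ : IsPolicy μ c Q) :
    IsPolicy μ c (midPolicy P Q) := by
  refine ⟨(hP.measurable.add hQ.measurable).div_const 2, fun ω => ?_,
    (hP.integrable.add hQ.integrable).div_const 2, ?_⟩
  · have := hP.nonneg ω; have := hQ.nonneg ω; unfold midPolicy; positivity
  · unfold midPolicy
    rw [integral_div, integral_add hP.integrable hQ.integrable]
    linarith [hP.average_le, hQ.average_le]

lemma sqrt_mid_ge {x y : ℝ} (hx : 0 ≤ x) (hy : 0 ≤ y) :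
    (√x + √y) / 2 ≤ √((x + y) / 2) := by
  refine Real.le_sqrt_of_sq_le ?_
  nlinarith [Real.sq_sqrt hx, Real.sq_sqrt hy, sq_nonneg (√x - √y)]

lemma integral_abs_sqrt_sub_le [IsProbabilityMeasure μ] {c η : ℝ} {P Q : Ω → ℝ}
    (hP : IsPolicy μ c P) (hQ : IsPolicy μ c Q) (hη : 0 < η) :
    ∫ ω, |√(P ω) - √(Q ω)| ∂μ ≤
      3 / η * (∫ ω, √(midPolicy P Q ω) ∂μ - (∫ ω, √(P ω) ∂μ + ∫ ω, √(Q ω) ∂μ) / 2)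
        + η * (1 + c) := by
  have iP := hP.integrable_sqrt
  have iQ := hQ.integrable_sqrt
  have iM := (hP.mid hQ).integrable_sqrt
  have iS : Integrable (fun ω => √(P ω) + √(Q ω)) μ := iP.add iQ
  have iG : Integrable (fun ω => √(midPolicy P Q ω) - (√(P ω) + √(Q ω)) / 2) μ :=
    iM.sub (iS.div_const 2)
  calc ∫ ω, |√(P ω) - √(Q ω)| ∂μ
      ≤ ∫ ω, (3 / η * (√(midPolicy P Q ω) - (√(P ω) + √(Q ω)) / 2)
          + η / 2 * (√(P ω) + √(Q ω))) ∂μ :=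
        integral_mono (iP.sub iQ).abs ((iG.const_mul _).add (iS.const_mul _)) fun ω =>
          abs_sqrt_sub_sqrt_le (hP.nonneg ω) (hQ.nonneg ω) hη
    _ = 3 / η * (∫ ω, √(midPolicy P Q ω) ∂μ - (∫ ω, √(P ω) ∂μ + ∫ ω, √(Q ω) ∂μ) / 2)
          + η / 2 * (∫ ω, √(P ω) ∂μ + ∫ ω, √(Q ω) ∂μ) := by
        rw [integral_add (iG.const_mul _) (iS.const_mul _), integral_const_mul,
          integral_const_mul, integral_sub iM (iS.div_const 2), integral_div, integral_add iP iQ]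
    _ ≤ _ := by
        have := hP.integral_sqrt_le
        have := hQ.integral_sqrt_le
        nlinarith

lemma integral_sqrt_mid_ge [IsProbabilityMeasure μ] {c : ℝ} {P Q : Ω → ℝ}
    (hP : IsPolicy μ c P) (hQ : IsPolicy μ c Q) :
    (∫ ω, √(P ω) ∂μ + ∫ ω, √(Q ω) ∂μ) / 2 ≤ ∫ ω, √(midPolicy P Q ω) ∂μ := by
  have iP := hP.integrable_sqrt
  have iQ := hQ.integrable_sqrt
  rw [← integral_add iP iQ, ← integral_div]
  exact integral_mono ((iP.add iQ).div_const 2) (hP.mid hQ).integrable_sqrt fun ω =>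
    sqrt_mid_ge (hP.nonneg ω) (hQ.nonneg ω)

/-- A decreasing sequence of nonempty midpoint-convex sets of policy pairs contains a sequence that
converges almost surely. -/
theorem exists_seq_mem_tendsto_ae [IsProbabilityMeasure μ] {c₁ c₂ : ℝ}
    {K : ℕ → Set ((Ω → ℝ) × (Ω → ℝ))} (hK : Antitone K) (hne : ∀ k, (K k).Nonempty)
    (hpol : ∀ k, ∀ z ∈ K k, IsPolicy μ c₁ z.1 ∧ IsPolicy μ c₂ z.2)
    (hmid : ∀ k, ∀ z ∈ K k, ∀ w ∈ K k, (midPolicy z.1 w.1, midPolicy z.2 w.2) ∈ K k) :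
    ∃ (z : ℕ → (Ω → ℝ) × (Ω → ℝ)) (P₁ P₂ : Ω → ℝ), (∀ k, z k ∈ K k) ∧
      Measurable P₁ ∧ Measurable P₂ ∧ (∀ ω, 0 ≤ P₁ ω) ∧ (∀ ω, 0 ≤ P₂ ω) ∧
      (∀ᵐ ω ∂μ, Tendsto (fun k => (z k).1 ω) atTop (𝓝 (P₁ ω))) ∧
      (∀ᵐ ω ∂μ, Tendsto (fun k => (z k).2 ω) atTop (𝓝 (P₂ ω))) := by
  -- A bounded strictly concave functional. Near-maximizers of it over the shrinking convex sets
  -- have midpoints that cannot do much better, and the concavity gap of the square root then makes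
  -- them Cauchy.
  set Φ : (Ω → ℝ) × (Ω → ℝ) → ℝ := fun z => ∫ ω, √(z.1 ω) ∂μ + ∫ ω, √(z.2 ω) ∂μ with hΦ
  have hΦ0 : ∀ z, 0 ≤ Φ z := fun z =>
    add_nonneg (integral_nonneg fun _ => Real.sqrt_nonneg _)
      (integral_nonneg fun _ => Real.sqrt_nonneg _)
  have hbdd : ∀ k, BddAbove (Φ '' K k) := fun k => ⟨(1 + c₁) + (1 + c₂), by
    rintro _ ⟨z, hz, rfl⟩
    exact add_le_add (hpol k z hz).1.integral_sqrt_le (hpol k z hz).2.integral_sqrt_le⟩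
  set m : ℕ → ℝ := fun k => sSup (Φ '' K k) with hm
  have hm_anti : Antitone m := fun j k hjk =>
    csSup_le_csSup (hbdd j) ((hne k).image _) (Set.image_mono (hK hjk))
  have hm0 : ∀ k, 0 ≤ m k := fun k => by
    obtain ⟨z, hz⟩ := hne k
    exact (hΦ0 z).trans (le_csSup (hbdd k) ⟨z, hz, rfl⟩)
  have hmlim : Tendsto m atTop (𝓝 (⨅ k, m k)) :=
    tendsto_atTop_ciInf hm_anti ⟨0, by rintro _ ⟨k, rfl⟩; exact hm0 k⟩
  have hz : ∀ k : ℕ, ∃ z ∈ K k, m k - 1 / ((k : ℝ) + 1) < Φ z := fun k => by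
    obtain ⟨_, ⟨z, hz, rfl⟩, h⟩ := exists_lt_of_lt_csSup ((hne k).image Φ)
      (show m k - 1 / ((k : ℝ) + 1) < m k by
        have : 0 < 1 / ((k : ℝ) + 1) := by positivity
        linarith)
    exact ⟨z, hz, h⟩
  choose z hzK hzΦ using hz
  have hgap : ∀ δ > 0, ∃ N, ∀ k ≥ N,
      Φ (midPolicy (z k).1 (z N).1, midPolicy (z k).2 (z N).2) - (Φ (z k) + Φ (z N)) / 2 < δ := by
    intro δ hδ
    have h1 : ∀ᶠ k in atTop, m k < (⨅ k, m k) + δ := hmlim.eventually_lt_const (by linarith)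
    have h2 : ∀ᶠ k : ℕ in atTop, 1 / ((k : ℝ) + 1) < δ / 2 :=
      tendsto_one_div_add_atTop_nhds_zero_nat.eventually_lt_const (by linarith)
    obtain ⟨N, hN1, hN2⟩ := (h1.and h2).exists
    refine ⟨N, fun k hk => ?_⟩
    have h3 : Φ (midPolicy (z k).1 (z N).1, midPolicy (z k).2 (z N).2) ≤ m N :=
      le_csSup (hbdd N) ⟨_, hmid N _ (hK hk (hzK k)) _ (hzK N), rfl⟩
    have h4 : (⨅ k, m k) ≤ m k := ciInf_le ⟨0, by rintro _ ⟨k, rfl⟩; exact hm0 k⟩ k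
    have h5 := hzΦ k
    have h6 := hzΦ N
    have h7 : 1 / ((k : ℝ) + 1) ≤ 1 / ((N : ℝ) + 1) := by
      have : (N : ℝ) ≤ k := by exact_mod_cast hk
      exact one_div_le_one_div_of_le (by positivity) (by linarith)
    linarith
  have hC1 : ∀ ε > 0, ∃ N, ∀ k ≥ N, ∫ ω, |√((z k).1 ω) - √((z N).1 ω)| ∂μ < ε ∧
      ∫ ω, |√((z k).2 ω) - √((z N).2 ω)| ∂μ < ε := by
    intro ε hε
    set B := |1 + c₁| + |1 + c₂| + 1 with hB
    have hB0 : 0 < B := by positivity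
    set η := ε / (2 * B) with hη
    have hη0 : 0 < η := by positivity
    -- Chosen so that $(3/\eta)\cdot\eta\varepsilon/6=\varepsilon/2$, while $\eta$ bounds the other
    -- error term $\eta(1+c_i)$ by $\varepsilon/2$.
    obtain ⟨N, hN⟩ := hgap (η * ε / 6) (by positivity)
    refine ⟨N, fun k hk => ?_⟩
    have hG := hN k hk
    obtain ⟨p1, p2⟩ := hpol k _ (hzK k)
    obtain ⟨q1, q2⟩ := hpol N _ (hzK N)
    have e1 := integral_abs_sqrt_sub_le p1 q1 hη0
    have e2 := integral_abs_sqrt_sub_le p2 q2 hη0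
    have g1 := integral_sqrt_mid_ge p1 q1
    have g2 := integral_sqrt_mid_ge p2 q2
    simp only [hΦ] at hG
    have hηB : η * B = ε / 2 := by rw [hη]; field_simp
    have b1 : η * (1 + c₁) ≤ ε / 2 := by
      rw [← hηB]
      exact mul_le_mul_of_nonneg_left
        (by rw [hB]; linarith [le_abs_self (1 + c₁), abs_nonneg (1 + c₂)]) hη0.le
    have b2 : η * (1 + c₂) ≤ ε / 2 := by
      rw [← hηB]
      exact mul_le_mul_of_nonneg_left
        (by rw [hB]; linarith [le_abs_self (1 + c₂), abs_nonneg (1 + c₁)]) hη0.le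
    have key : ∀ x, x < η * ε / 6 → 3 / η * x < ε / 2 := fun x hx => by
      calc 3 / η * x < 3 / η * (η * ε / 6) := mul_lt_mul_of_pos_left hx (by positivity)
        _ = ε / 2 := by field_simp; norm_num
    constructor
    · linarith [key _ (show _ < η * ε / 6 by linarith [hG, g2] :
        ∫ ω, √(midPolicy (z k).1 (z N).1 ω) ∂μ
          - (∫ ω, √((z k).1 ω) ∂μ + ∫ ω, √((z N).1 ω) ∂μ) / 2 < η * ε / 6)]
    · linarith [key _ (show _ < η * ε / 6 by linarith [hG, g1] :
        ∫ ω, √(midPolicy (z k).2 (z N).2 ω) ∂μ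
          - (∫ ω, √((z k).2 ω) ∂μ + ∫ ω, √((z N).2 ω) ∂μ) / 2 < η * ε / 6)]
  obtain ⟨v₁, φ, hv₁, hφ, hlim₁⟩ := exists_subseq_tendsto_ae_of_cauchy
    (u := fun k ω => √((z k).1 ω)) (fun k => (hpol k _ (hzK k)).1.integrable_sqrt)
    (fun ε hε => (hC1 ε hε).imp fun N hN k hk => (hN k hk).1)
  obtain ⟨v₂, χ, hv₂, hχ, hlim₂⟩ := exists_subseq_tendsto_ae_of_cauchy
    (μ := μ) (u := fun k ω => √((z (φ k)).2 ω))
    (fun k => (hpol _ _ (hzK (φ k))).2.integrable_sqrt) (by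
      intro ε hε
      -- The reference term along the subsequence is `φ N`, not `N`; both terms are compared with
      -- the term `N`, hence the halved tolerance.
      obtain ⟨N, hN⟩ := hC1 (ε / 2) (by linarith)
      refine ⟨N, fun k hk => ?_⟩
      have i := fun k => (hpol _ _ (hzK k)).2.integrable_sqrt
      have e1 := (hN (φ k) (hk.le.trans (hφ.id_le k))).2
      have e2 := (hN (φ N) (hφ.id_le N)).2
      calc ∫ ω, |√((z (φ k)).2 ω) - √((z (φ N)).2 ω)| ∂μ
          ≤ ∫ ω, (|√((z (φ k)).2 ω) - √((z N).2 ω)| + |√((z (φ N)).2 ω) - √((z N).2 ω)|) ∂μ := by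
            refine integral_mono ((i _).sub (i _)).abs
              (((i _).sub (i _)).abs.add ((i _).sub (i _)).abs) fun ω => ?_
            dsimp only
            rw [abs_sub_comm (√((z (φ N)).2 ω))]
            exact abs_sub_le _ _ _
        _ = _ := integral_add ((i _).sub (i _)).abs ((i _).sub (i _)).abs
        _ < ε := by linarith)
  refine ⟨fun k => z (φ (χ k)), fun ω => v₁ ω ^ 2, fun ω => v₂ ω ^ 2, fun k => ?_,
    hv₁.pow_const 2, hv₂.pow_const 2, fun _ => sq_nonneg _, fun _ => sq_nonneg _, ?_, ?_⟩
  · exact hK ((hχ.id_le k).trans (hφ.id_le (χ k))) (hzK _)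
  · filter_upwards [hlim₁] with ω hω
    refine ((hω.comp hχ.tendsto_atTop).pow 2).congr fun k => ?_
    exact Real.sq_sqrt ((hpol _ _ (hzK _)).1.nonneg ω)
  · filter_upwards [hlim₂] with ω hω
    refine (hω.pow 2).congr fun k => ?_
    exact Real.sq_sqrt ((hpol _ _ (hzK _)).2.nonneg ω)

end FadingMAC

/-! ### Joint information: concavity and existence of a maximizer -/

namespace FadingMAC

open Filter Topology

/-- Midpoint log-concavity of the joint gain. Its homogenization satisfies a reversed Cauchy–Schwarz
inequality $uv\le B^2$: of the two expressions for $4(B^2-uv)$ below, one is visibly nonnegative for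
each sign of $(p'-p)(q'-q)$. -/
lemma joint_gain_mul_le_sq {a b d p q p' q' : ℝ} (ha : 0 ≤ a) (hb : 0 ≤ b) (hd : 0 ≤ d)
    (hdab : d ≤ a * b) (hp : 0 ≤ p) (hq : 0 ≤ q) (hp' : 0 ≤ p') (hq' : 0 ≤ q') :
    (1 + p * a + q * b + p * q * d) * (1 + p' * a + q' * b + p' * q' * d) ≤
      (1 + (p + p') / 2 * a + (q + q') / 2 * b + (p + p') / 2 * ((q + q') / 2) * d) ^ 2 := by
  obtain ⟨u, hu⟩ : ∃ u, u = 1 + p * a + q * b + p * q * d := ⟨_, rfl⟩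
  obtain ⟨v, hv⟩ : ∃ v, v = 1 + p' * a + q' * b + p' * q' * d := ⟨_, rfl⟩
  -- polarization of the joint gain, a quadratic form in the homogenized powers
  obtain ⟨B, hB⟩ : ∃ B, B = 1 + (p + p') / 2 * a + (q + q') / 2 * b
    + (p * q' + p' * q) / 2 * d := ⟨_, rfl⟩
  have hu0 : 0 ≤ u := by rw [hu]; positivity
  have hv0 : 0 ≤ v := by rw [hv]; positivity
  have hB0 : 0 ≤ B := by rw [hB]; positivity
  have hpol : 1 + (p + p') / 2 * a + (q + q') / 2 * b + (p + p') / 2 * ((q + q') / 2) * d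
      = (u + v + 2 * B) / 4 := by rw [hu, hv, hB]; ring
  have hid : 4 * (B ^ 2 - u * v) = ((p' - p) * (a + q * d) + (q' - q) * (b + p * d)) ^ 2
      - 4 * ((p' - p) * (q' - q)) * (d * u) := by rw [hu, hv, hB]; ring
  have hid' : 4 * (B ^ 2 - u * v) = ((p' - p) * (a + q * d) - (q' - q) * (b + p * d)) ^ 2
      + 4 * ((p' - p) * (q' - q) * (a * b - d)) := by rw [hu, hv, hB]; ring
  have hcs : u * v ≤ B ^ 2 := by
    rcases le_total 0 ((p' - p) * (q' - q)) with h | h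
    · have h1 := mul_nonneg h (sub_nonneg.2 hdab)
      have h2 := sq_nonneg ((p' - p) * (a + q * d) - (q' - q) * (b + p * d))
      linarith
    · have h1 := mul_nonneg (neg_nonneg.2 h) (mul_nonneg hd hu0)
      have h2 := sq_nonneg ((p' - p) * (a + q * d) + (q' - q) * (b + p * d))
      linarith
  rw [hpol, ← hu, ← hv]
  clear hu hv hB hpol hid hid'
  have h4 : 4 * (u * v) ≤ (u + v) ^ 2 := by nlinarith [sq_nonneg (u - v)]
  have h5 : 2 * (u * v) ≤ (u + v) * B := by
    refine (abs_le_of_sq_le_sq' ?_ (by positivity)).2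
    calc (2 * (u * v)) ^ 2 = 4 * (u * v) * (u * v) := by ring
      _ ≤ (u + v) ^ 2 * B ^ 2 := mul_le_mul h4 hcs (by positivity) (by positivity)
      _ = ((u + v) * B) ^ 2 := by ring
  nlinarith

variable {Ω : Type*} [MeasurableSpace Ω]

/-- `E[log (1 + P a + Q b + P Q d)]`. -/
noncomputable def sumLog (μ : Measure Ω) (a b d P Q : Ω → ℝ) : ℝ :=
  ∫ ω, Real.log (1 + P ω * a ω + Q ω * b ω + P ω * Q ω * d ω) ∂μ

variable {μ : Measure Ω} {a b d P Q : Ω → ℝ} {c₁ c₂ : ℝ}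

lemma sumLog_swap : sumLog μ b a d Q P = sumLog μ a b d P Q := by
  unfold sumLog
  congr 1; ext ω; congr 1; ring

lemma sumLog_zero_right : sumLog μ a b d P 0 = logValue μ a P := by
  unfold sumLog logValue; simp

lemma sumLog_zero_left : sumLog μ a b d 0 Q = logValue μ b Q := by
  unfold sumLog logValue; simp

lemma log_joint_gain {a b d p q : ℝ} (ha : 0 ≤ a) (hb : 0 ≤ b) (hd : 0 ≤ d) (hp : 0 ≤ p)
    (hq : 0 ≤ q) : Real.log (1 + p * a + q * b + p * q * d) =
      Real.log (1 + q * b) + Real.log (1 + p * gain a b d q) := by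
  rw [← one_add_mul_one_add_gain p hb hq, Real.log_mul (by positivity)]
  have := gain_nonneg ha hb hd hq
  positivity

/-- Decoding user 1 first on `D` and user 2 first elsewhere, the rates add up to the joint
information. -/
lemma logValue_add_logValue (h : IsGainPair μ a b d) {D : Set Ω} (hD : MeasurableSet D)
    (hP : IsPolicy μ c₁ P) (hQ : IsPolicy μ c₂ Q) :
    logValue μ (gainUnder a b d (D.indicator Q)) P
      + logValue μ (gainUnder b a d (Dᶜ.indicator P)) Q = sumLog μ a b d P Q := by
  unfold logValue sumLog
  rw [← integral_add
    ((h.isGain_indicator hD hQ.measurable hQ.nonneg).integrable_log_one_add_mul hP)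
    ((h.swap.isGain_indicator hD.compl hP.measurable hP.nonneg).integrable_log_one_add_mul hQ)]
  congr 1; ext ω
  have ha := h.fst.nonneg ω
  have hb := h.snd.nonneg ω
  have hd := h.gram_nonneg ω
  have hp := hP.nonneg ω
  have hq := hQ.nonneg ω
  by_cases hω : ω ∈ D
  · simp only [gainUnder, Set.indicator_of_mem hω, Set.indicator_of_notMem (fun h' => h' hω :
      ω ∉ Dᶜ), gain_zero]
    rw [log_joint_gain ha hb hd hp hq, add_comm]
  · simp only [gainUnder, Set.indicator_of_notMem hω, Set.indicator_of_mem (show ω ∈ Dᶜ from hω),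
      gain_zero]
    rw [show 1 + P ω * a ω + Q ω * b ω + P ω * Q ω * d ω
      = 1 + Q ω * b ω + P ω * a ω + Q ω * P ω * d ω by ring, log_joint_gain hb ha hd hq hp]

lemma logValue_add_logValue_univ (h : IsGainPair μ a b d)
    (hP : IsPolicy μ c₁ P) (hQ : IsPolicy μ c₂ Q) :
    logValue μ (gainUnder a b d Q) P + logValue μ b Q = sumLog μ a b d P Q := by
  have := logValue_add_logValue h MeasurableSet.univ hP hQ
  simpa [show gainUnder b a d (fun _ => 0) = b from funext fun ω => gain_zero _ _ _] using this

/-- The slope in $p$ is as small as desired at the price of a constant; this is the uniform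
integrability behind the passage to the limit in `sumLog_ge_of_tendsto`. -/
lemma log_one_add_le_mul_add {p ε : ℝ} (hp : 0 ≤ p) (hε : 0 < ε) :
    Real.log (1 + p) ≤ ε * p + (ε - 1 - Real.log ε) := by
  have := Real.log_le_sub_one_of_pos (show 0 < ε * (1 + p) by positivity)
  rw [Real.log_mul hε.ne' (by positivity)] at this
  linarith

lemma log_joint_gain_le {a b d p q ε : ℝ} (ha : 0 ≤ a) (hb : 0 ≤ b) (hd : 0 ≤ d)
    (hdab : d ≤ a * b) (hp : 0 ≤ p) (hq : 0 ≤ q) (hε : 0 < ε) :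
    Real.log (1 + p * a + q * b + p * q * d) ≤
      Real.log (1 + a) + Real.log (1 + b) + 2 * (ε - 1 - Real.log ε) + ε * (p + q) := by
  have h1 := log_one_add_mul_le hp ha
  have h2 := log_one_add_mul_le hq hb
  have h3 := log_one_add_le_mul_add hp hε
  have h4 := log_one_add_le_mul_add hq hε
  have h5 : Real.log (1 + p * a + q * b + p * q * d)
      ≤ Real.log (1 + p * a) + Real.log (1 + q * b) := by
    rw [← Real.log_mul (by positivity) (by positivity)]
    exact Real.log_le_log (by positivity)
      (by nlinarith [mul_le_mul_of_nonneg_left hdab (mul_nonneg hp hq)])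
  linarith

lemma integrable_log_joint_gain (h : IsGainPair μ a b d) (hP : IsPolicy μ c₁ P)
    (hQ : IsPolicy μ c₂ Q) :
    Integrable (fun ω => Real.log (1 + P ω * a ω + Q ω * b ω + P ω * Q ω * d ω)) μ := by
  refine ((h.fst.integrable_log.add h.snd.integrable_log).add
    (hP.integrable.add hQ.integrable)).mono' ?_ (Eventually.of_forall fun ω => ?_)
  · exact ((((hP.measurable.mul h.fst.measurable).const_add 1).add
      (hQ.measurable.mul h.snd.measurable)).add
      ((hP.measurable.mul hQ.measurable).mul h.measurable_gram)).log.aestronglyMeasurable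
  · have ha := h.fst.nonneg ω
    have hb := h.snd.nonneg ω
    have hd := h.gram_nonneg ω
    have hp := hP.nonneg ω
    have hq := hQ.nonneg ω
    have h0 : 0 ≤ P ω * a ω + Q ω * b ω + P ω * Q ω * d ω := by positivity
    rw [Real.norm_eq_abs, abs_of_nonneg (Real.log_nonneg (by linarith))]
    have := log_joint_gain_le ha hb hd (h.gram_le ω) hp hq one_pos
    simpa using this

lemma sumLog_le (h : IsGainPair μ a b d) (hP : IsPolicy μ c₁ P) (hQ : IsPolicy μ c₂ Q) :
    sumLog μ a b d P Q ≤
      ∫ ω, (Real.log (1 + a ω) + Real.log (1 + b ω)) ∂μ + (c₁ + c₂) := by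
  calc sumLog μ a b d P Q
      ≤ ∫ ω, ((Real.log (1 + a ω) + Real.log (1 + b ω)) + (P ω + Q ω)) ∂μ := by
        refine integral_mono (integrable_log_joint_gain h hP hQ)
          ((h.fst.integrable_log.add h.snd.integrable_log).add
            (hP.integrable.add hQ.integrable)) fun ω => ?_
        have := log_joint_gain_le (h.fst.nonneg ω) (h.snd.nonneg ω) (h.gram_nonneg ω)
          (h.gram_le ω) (hP.nonneg ω) (hQ.nonneg ω) one_pos
        simpa using this
    _ = ∫ ω, (Real.log (1 + a ω) + Real.log (1 + b ω)) ∂μ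
          + (∫ ω, P ω ∂μ + ∫ ω, Q ω ∂μ) := by
        rw [← integral_add hP.integrable hQ.integrable]
        exact integral_add (h.fst.integrable_log.add h.snd.integrable_log)
          (hP.integrable.add hQ.integrable)
    _ ≤ _ := by linarith [hP.average_le, hQ.average_le]

lemma sumLog_mid_ge {P' Q' : Ω → ℝ} (h : IsGainPair μ a b d) (hP : IsPolicy μ c₁ P)
    (hQ : IsPolicy μ c₂ Q) (hP' : IsPolicy μ c₁ P') (hQ' : IsPolicy μ c₂ Q') :
    (sumLog μ a b d P Q + sumLog μ a b d P' Q') / 2 ≤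
      sumLog μ a b d (midPolicy P P') (midPolicy Q Q') := by
  have i := integrable_log_joint_gain h hP hQ
  have i' := integrable_log_joint_gain h hP' hQ'
  unfold sumLog
  rw [← integral_add i i', ← integral_div]
  refine integral_mono ((i.add i').div_const 2)
    (integrable_log_joint_gain h (hP.mid hP') (hQ.mid hQ')) fun ω => ?_
  have ha := h.fst.nonneg ω
  have hb := h.snd.nonneg ω
  have hd := h.gram_nonneg ω
  have hp := hP.nonneg ω
  have hq := hQ.nonneg ω
  have hp' := hP'.nonneg ω
  have hq' := hQ'.nonneg ω
  have key := Real.log_le_log (by positivity)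
    (joint_gain_mul_le_sq ha hb hd (h.gram_le ω) hp hq hp' hq')
  rw [Real.log_mul (by positivity) (by positivity), Real.log_pow] at key
  push_cast at key
  simp only [midPolicy]
  linarith

lemma isPolicy_zero {c : ℝ} (hc : 0 ≤ c) : IsPolicy μ c (0 : Ω → ℝ) :=
  ⟨measurable_const, fun _ => le_rfl, integrable_zero _ _ _, by simpa using hc⟩

lemma IsPolicy.of_tendsto {c : ℝ} {z : ℕ → Ω → ℝ} (hz : ∀ k, IsPolicy μ c (z k))
    (hP : Measurable P) (hP0 : ∀ ω, 0 ≤ P ω)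
    (hlim : ∀ᵐ ω ∂μ, Tendsto (fun k => z k ω) atTop (𝓝 (P ω))) : IsPolicy μ c P := by
  obtain ⟨hi, hle⟩ := integrable_and_integral_le_of_tendsto (fun k => (hz k).integrable)
    (fun k => (hz k).nonneg) hP hlim (fun k => (hz k).average_le) tendsto_const_nhds
  exact ⟨hP, hP0, hi, hle⟩

/-- Upper semicontinuity by Fatou's lemma applied to an integrable majorant plus $\varepsilon(P+Q)$
minus the logarithm, which is nonnegative. Power lost in the limit costs at most
$\varepsilon(c_1+c_2)=\delta$. -/
lemma sumLog_ge_of_tendsto [IsProbabilityMeasure μ] (h : IsGainPair μ a b d)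
    {z : ℕ → (Ω → ℝ) × (Ω → ℝ)}
    (hz₁ : ∀ k, IsPolicy μ c₁ (z k).1) (hz₂ : ∀ k, IsPolicy μ c₂ (z k).2)
    (hP : IsPolicy μ c₁ P) (hQ : IsPolicy μ c₂ Q)
    (hlim₁ : ∀ᵐ ω ∂μ, Tendsto (fun k => (z k).1 ω) atTop (𝓝 (P ω)))
    (hlim₂ : ∀ᵐ ω ∂μ, Tendsto (fun k => (z k).2 ω) atTop (𝓝 (Q ω)))
    {s : ℕ → ℝ} {M : ℝ} (hs : ∀ k, s k ≤ sumLog μ a b d (z k).1 (z k).2)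
    (hsM : Tendsto s atTop (𝓝 M)) (hc : 0 < c₁ + c₂) : M ≤ sumLog μ a b d P Q := by
  refine le_of_forall_pos_le_add fun δ hδ => ?_
  set ε := δ / (c₁ + c₂) with hε
  have hε0 : 0 < ε := by positivity
  set L : Ω → ℝ := fun ω =>
    Real.log (1 + a ω) + Real.log (1 + b ω) + 2 * (ε - 1 - Real.log ε) with hL
  have hLi : Integrable L μ :=
    (h.fst.integrable_log.add h.snd.integrable_log).add (integrable_const _)
  set T : (Ω → ℝ) → (Ω → ℝ) → Ω → ℝ := fun P Q ω =>
    L ω + ε * (P ω + Q ω) - Real.log (1 + P ω * a ω + Q ω * b ω + P ω * Q ω * d ω) with hT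
  have hTi : ∀ {P Q : Ω → ℝ}, IsPolicy μ c₁ P → IsPolicy μ c₂ Q → Integrable (T P Q) μ :=
    fun hP hQ => (hLi.add ((hP.integrable.add hQ.integrable).const_mul ε)).sub
      (integrable_log_joint_gain h hP hQ)
  have hTint : ∀ {P Q : Ω → ℝ}, IsPolicy μ c₁ P → IsPolicy μ c₂ Q →
      ∫ ω, T P Q ω ∂μ = ∫ ω, L ω ∂μ + ε * (∫ ω, P ω ∂μ + ∫ ω, Q ω ∂μ) - sumLog μ a b d P Q := by
    intro P Q hP hQ
    have iS : Integrable (fun ω => ε * (P ω + Q ω)) μ :=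
      (hP.integrable.add hQ.integrable).const_mul ε
    rw [← integral_add hP.integrable hQ.integrable, ← integral_const_mul, ← integral_add hLi iS]
    exact integral_sub (hLi.add iS) (integrable_log_joint_gain h hP hQ)
  have hTm : Measurable (T P Q) := by
    have := hP.measurable
    have := hQ.measurable
    have := h.fst.measurable
    have := h.snd.measurable
    have := h.measurable_gram
    rw [hT, hL]
    fun_prop
  obtain ⟨-, hle⟩ := integrable_and_integral_le_of_tendsto
    (f := fun k => T (z k).1 (z k).2) (g := T P Q)
    (c := fun k => ∫ ω, L ω ∂μ + ε * (c₁ + c₂) - s k)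
    (fun k => hTi (hz₁ k) (hz₂ k))
    (fun k ω => by
      have := log_joint_gain_le (h.fst.nonneg ω) (h.snd.nonneg ω) (h.gram_nonneg ω)
        (h.gram_le ω) ((hz₁ k).nonneg ω) ((hz₂ k).nonneg ω) hε0
      simp only [hT, hL]
      linarith)
    hTm
    (by
      filter_upwards [hlim₁, hlim₂] with ω h1 h2
      have ha := h.fst.nonneg ω
      have hb := h.snd.nonneg ω
      have hd := h.gram_nonneg ω
      have hp := hP.nonneg ω
      have hq := hQ.nonneg ω
      have hpos : 1 + P ω * a ω + Q ω * b ω + P ω * Q ω * d ω ≠ 0 := by positivity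
      refine (((h1.add h2).const_mul ε).const_add (L ω)).sub (Tendsto.log ?_ hpos)
      exact (((h1.mul_const _).const_add 1).add (h2.mul_const _)).add ((h1.mul h2).mul_const _))
    (fun k => by
      rw [hTint (hz₁ k) (hz₂ k)]
      have := mul_le_mul_of_nonneg_left
        (add_le_add (hz₁ k).average_le (hz₂ k).average_le) hε0.le
      linarith [hs k])
    (hsM.const_sub _)
  rw [hTint hP hQ] at hle
  have h0 : 0 ≤ ε * (∫ ω, P ω ∂μ + ∫ ω, Q ω ∂μ) :=
    mul_nonneg hε0.le (add_nonneg (integral_nonneg hP.nonneg) (integral_nonneg hQ.nonneg))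
  have hεδ : ε * (c₁ + c₂) = δ := by rw [hε]; field_simp
  linarith

/-- The joint information has a maximizer among the policies with given average powers. -/
theorem exists_max_sumLog [IsProbabilityMeasure μ] (h : IsGainPair μ a b d)
    (hc₁ : 0 < c₁) (hc₂ : 0 < c₂) :
    ∃ P Q, IsPolicy μ c₁ P ∧ IsPolicy μ c₂ Q ∧ ∀ P' Q', IsPolicy μ c₁ P' → IsPolicy μ c₂ Q' →
      sumLog μ a b d P' Q' ≤ sumLog μ a b d P Q := by
  set V : Set ℝ := {v | ∃ P Q, IsPolicy μ c₁ P ∧ IsPolicy μ c₂ Q ∧ sumLog μ a b d P Q = v} with hV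
  have hVne : V.Nonempty := ⟨_, 0, 0, isPolicy_zero hc₁.le, isPolicy_zero hc₂.le, rfl⟩
  have hVb : BddAbove V := ⟨_, by rintro _ ⟨P, Q, hP, hQ, rfl⟩; exact sumLog_le h hP hQ⟩
  set M := sSup V with hM
  set s : ℕ → ℝ := fun k => M - 1 / ((k : ℝ) + 1) with hs
  have hsM : Tendsto s atTop (𝓝 M) := by
    simpa only [sub_zero] using tendsto_one_div_add_atTop_nhds_zero_nat.const_sub M
  obtain ⟨z, P, Q, hzK, hPm, hQm, hP0, hQ0, hlim₁, hlim₂⟩ := exists_seq_mem_tendsto_ae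
    (μ := μ) (c₁ := c₁) (c₂ := c₂)
    (K := fun k => {z | IsPolicy μ c₁ z.1 ∧ IsPolicy μ c₂ z.2 ∧ s k ≤ sumLog μ a b d z.1 z.2})
    (fun j k hjk z hz => ⟨hz.1, hz.2.1, le_trans (by
      have : (j : ℝ) ≤ k := by exact_mod_cast hjk
      have := one_div_le_one_div_of_le (show 0 < (j : ℝ) + 1 by positivity)
        (add_le_add_left this 1)
      simp only [hs]
      linarith) hz.2.2⟩)
    (fun k => by
      obtain ⟨_, ⟨P, Q, hP, hQ, rfl⟩, hlt⟩ := exists_lt_of_lt_csSup hVne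
        (show s k < M by
          have : 0 < 1 / ((k : ℝ) + 1) := by positivity
          simp only [hs]
          linarith)
      exact ⟨(P, Q), hP, hQ, hlt.le⟩)
    (fun k z hz => ⟨hz.1, hz.2.1⟩)
    (fun k z hz w hw => ⟨hz.1.mid hw.1, hz.2.1.mid hw.2.1, by
      have := sumLog_mid_ge h hz.1 hz.2.1 hw.1 hw.2.1
      have := hz.2.2
      have := hw.2.2
      dsimp only
      linarith⟩)
  have hP := IsPolicy.of_tendsto (fun k => (hzK k).1) hPm hP0 hlim₁
  have hQ := IsPolicy.of_tendsto (fun k => (hzK k).2.1) hQm hQ0 hlim₂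
  have hge := sumLog_ge_of_tendsto h (fun k => (hzK k).1) (fun k => (hzK k).2.1) hP hQ hlim₁ hlim₂
    (fun k => (hzK k).2.2) hsM (by positivity)
  exact ⟨P, Q, hP, hQ, fun P' Q' hP' hQ' => (le_csSup hVb ⟨P', Q', hP', hQ', rfl⟩).trans hge⟩

/-- A maximizer of the joint information consists of mutual best responses when each user suffers
the full interference of the other one. -/
lemma isBestResponse_of_max_sumLog (h : IsGainPair μ a b d)
    (hP : IsPolicy μ c₁ P) (hQ : IsPolicy μ c₂ Q)
    (hmax : ∀ P' Q', IsPolicy μ c₁ P' → IsPolicy μ c₂ Q' →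
      sumLog μ a b d P' Q' ≤ sumLog μ a b d P Q) :
    IsBestResponse μ c₁ (gainUnder a b d Q) P := by
  refine ⟨hP, fun P' hP' => ?_⟩
  have := hmax P' Q hP' hQ
  rw [← logValue_add_logValue_univ h hP' hQ, ← logValue_add_logValue_univ h hP hQ] at this
  linarith

end FadingMAC

/-! ### Optimal equilibria and time sharing -/

namespace FadingMAC

open Filter Topology

/-- The relation between the gains on which both users transmit at given water levels. -/
def IsCoupled (x y k a b d : ℝ) : Prop :=
  (x * (y * (b * d) + (a * b - d)) - y * b ^ 2) * ((a * b - d) - k * (b * d))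
    = k * b ^ 2 * (y * (b * d) + (a * b - d))

lemma inv_gain_eq {a b d q : ℝ} : (gain a b d q)⁻¹ = (1 + q * b) / (a + q * d) := inv_div _ _

/-- The two laws for $q$ give $(z-y)\,b(b+pd)=p(ab-d)$, whence $z>y$. With $X=b(a+qd)=ybd+ab-d$ the
law for $p$ reads $pX=xX-yb^2$, and eliminating $p$ between the two yields the relation. -/
lemma isCoupled_of_levels {a b d p q x y z : ℝ} (ha : 0 < a) (hb : 0 < b) (hd : 0 ≤ d)
    (hdab : d < a * b) (hp : 0 < p) (hq : 0 < q) (hpx : p = x - (gain a b d q)⁻¹)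
    (hqy : q = y - b⁻¹) (hqz : q = z - (gain b a d p)⁻¹) :
    0 < z - y ∧ IsCoupled x y (z - y) a b d := by
  rw [inv_gain_eq] at hpx hqz
  have hk : (z - y) * (b * (b + p * d)) = p * (a * b - d) := by
    have : z - y = (1 + p * a) / (b + p * d) - b⁻¹ := by linarith
    rw [this]
    field_simp
    ring
  have hk0 : 0 < z - y := by
    have h1 : 0 < p * (a * b - d) := mul_pos hp (sub_pos.2 hdab)
    rw [← hk] at h1
    exact pos_of_mul_pos_left h1 (by positivity)
  refine ⟨hk0, ?_⟩
  obtain ⟨k, hk'⟩ : ∃ k, k = z - y := ⟨_, rfl⟩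
  rw [← hk'] at hk ⊢
  have hy : y * b = 1 + q * b := by rw [hqy]; field_simp; ring
  have hX : y * (b * d) + (a * b - d) = b * (a + q * d) := by
    linear_combination d * hy
  have hpX : p * (a + q * d) = x * (a + q * d) - y * b := by
    rw [hpx, sub_mul, div_mul_cancel₀ _ (by positivity), hy]
  unfold IsCoupled
  rw [hX]
  linear_combination (-(b * (a * b - d - k * (b * d)))) * hpX - b * (a + q * d) * hk

variable {Ω : Type*} [MeasurableSpace Ω] {μ : Measure Ω} {a b d P Q : Ω → ℝ} {c₁ c₂ : ℝ}

/-- At an equilibrium at which user 2 also responds optimally to full interference, at most one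
user transmits on the set where user 2 does not suffer interference. -/
lemma ae_silent_of_isBestResponse [IsProbabilityMeasure μ] (h : IsGainPair μ a b d)
    (hc₁ : 0 < c₁) (hc₂ : 0 < c₂) (hstrict : ∀ᵐ ω ∂μ, d ω < a ω * b ω)
    (hgen : ∀ x y k, 0 < x → 0 < y → 0 < k → ∀ᵐ ω ∂μ, ¬ IsCoupled x y k (a ω) (b ω) (d ω))
    {D : Set Ω} (hD : MeasurableSet D) (hE : IsEquilibrium μ a b d c₁ c₂ D P Q)
    (hQ : IsBestResponse μ c₂ (gainUnder b a d P) Q) :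
    ∀ᵐ ω ∂μ, ω ∈ D → P ω = 0 ∨ Q ω = 0 := by
  obtain ⟨x, y, hx, hy, -, -, h1, h2⟩ := hE.exists_levels h hD hc₁ hc₂
  obtain ⟨z, hz, h3, -⟩ := hQ.exists_eq_waterfill
    (h.swap.isGain_gainUnder hE.best₁.isPolicy.measurable hE.best₁.isPolicy.nonneg) hc₂
  -- That $z>y$ is known only at states where both users transmit, so the genericity hypothesis is
  -- made conditional on it.
  have hgen' : ∀ᵐ ω ∂μ, 0 < z - y → ¬ IsCoupled x y (z - y) (a ω) (b ω) (d ω) := by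
    by_cases hk : 0 < z - y
    · filter_upwards [hgen x y (z - y) hx hy hk] with ω hω _ using hω
    · exact Eventually.of_forall fun ω h' => absurd h' hk
  filter_upwards [h1, h2, h3, hgen', hstrict, h.fst.pos, h.snd.pos] with
    ω e1 e2 e3 hg hs ha hb hωD
  by_contra! hne
  have hp : 0 < P ω := lt_of_le_of_ne (hE.best₁.isPolicy.nonneg ω) hne.1.symm
  have hq : 0 < Q ω := lt_of_le_of_ne (hE.best₂.isPolicy.nonneg ω) hne.2.symm
  have hωD' : ω ∉ Dᶜ := fun h' => h' hωD
  simp only [gainUnder, Set.indicator_of_mem hωD, Set.indicator_of_notMem hωD', gain_zero]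
    at e1 e2 e3
  rw [waterfill_eq_of_pos (e1 ▸ hp)] at e1
  have e2' := e2.trans (waterfill_eq_of_pos (e2 ▸ hq))
  have e3' := e3.trans (waterfill_eq_of_pos (e3 ▸ hq))
  obtain ⟨hk, hcoup⟩ := isCoupled_of_levels ha hb (h.gram_nonneg ω) hs hp hq e1 e2' e3'
  exact hg hk hcoup

/-- An equilibrium that maximizes the joint information shares time. -/
theorem ae_silent_of_max_sumLog [IsProbabilityMeasure μ] (h : IsGainPair μ a b d)
    (hc₁ : 0 < c₁) (hc₂ : 0 < c₂) (hstrict : ∀ᵐ ω ∂μ, d ω < a ω * b ω)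
    (hgen : ∀ x y k, 0 < x → 0 < y → 0 < k → ∀ᵐ ω ∂μ, ¬ IsCoupled x y k (a ω) (b ω) (d ω))
    (hgen' : ∀ x y k, 0 < x → 0 < y → 0 < k → ∀ᵐ ω ∂μ, ¬ IsCoupled x y k (b ω) (a ω) (d ω))
    {D : Set Ω} (hD : MeasurableSet D) (hE : IsEquilibrium μ a b d c₁ c₂ D P Q)
    (hmax : ∀ P' Q', IsPolicy μ c₁ P' → IsPolicy μ c₂ Q' →
      sumLog μ a b d P' Q' ≤ sumLog μ a b d P Q) :
    ∀ᵐ ω ∂μ, P ω = 0 ∨ Q ω = 0 := by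
  have hP := hE.best₁.isPolicy
  have hQ := hE.best₂.isPolicy
  have hmax' : ∀ Q' P', IsPolicy μ c₂ Q' → IsPolicy μ c₁ P' →
      sumLog μ b a d Q' P' ≤ sumLog μ b a d Q P := fun Q' P' hQ' hP' => by
    rw [sumLog_swap, sumLog_swap (P := P)]; exact hmax P' Q' hP' hQ'
  have hs' : ∀ᵐ ω ∂μ, d ω < b ω * a ω := by
    filter_upwards [hstrict] with ω hω; rwa [mul_comm]
  filter_upwards [ae_silent_of_isBestResponse h hc₁ hc₂ hstrict hgen hD hE
      (isBestResponse_of_max_sumLog h.swap hQ hP hmax'),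
    ae_silent_of_isBestResponse h.swap hc₂ hc₁ hs' hgen' hD.compl hE.swap
      (isBestResponse_of_max_sumLog h hP hQ hmax)] with ω h1 h2
  by_cases hω : ω ∈ D
  · exact h1 hω
  · exact (h2 hω).symm

/-- The silent user with gain `b` has no incentive to transmit when the other user water-fills
over `a`; `x` and `y` are the water levels. -/
def Silences (x y a b d : ℝ) : Prop := y * (x * (a * d) + (a * b - d)) ≤ x * a ^ 2

/-- With $xa=1+pa$, silence of the other user means $y(b+pd)\le xa$; multiplying by $a$ and
replacing $pa$ by $xa-1$ eliminates $p$. -/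
lemma silences_of_waterfill {x y a b d p : ℝ} (ha : 0 < a) (hb : 0 < b) (hd : 0 ≤ d)
    (hy : 0 < y) (hp : 0 < p) (hpx : p = x - a⁻¹) (hy' : y ≤ (gain b a d p)⁻¹) :
    1 < x * a ∧ y * b ≤ x * a ∧ Silences x y a b d := by
  have hxa : x * a = 1 + p * a := by rw [hpx]; field_simp; ring
  rw [inv_gain_eq, le_div_iff₀ (by positivity), ← hxa] at hy'
  refine ⟨by rw [hxa]; nlinarith [mul_pos hp ha], ?_, ?_⟩
  · nlinarith [mul_nonneg hy.le (mul_nonneg hp.le hd)]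
  · have := mul_le_mul_of_nonneg_left hy' ha.le
    unfold Silences
    linear_combination this + y * d * hxa

/-- The structure of the fading states under a maximizer of the joint information at which at most
one user transmits. -/
theorem exists_levels_of_silent [IsProbabilityMeasure μ] (h : IsGainPair μ a b d)
    (hc₁ : 0 < c₁) (hc₂ : 0 < c₂) (hP : IsPolicy μ c₁ P) (hQ : IsPolicy μ c₂ Q)
    (hmax : ∀ P' Q', IsPolicy μ c₁ P' → IsPolicy μ c₂ Q' →
      sumLog μ a b d P' Q' ≤ sumLog μ a b d P Q)
    (hsilent : ∀ᵐ ω ∂μ, P ω = 0 ∨ Q ω = 0) :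
    ∃ x y, 0 < x ∧ 0 < y ∧
      (∀ᵐ ω ∂μ, 1 < x * a ω → 1 < y * b ω →
        Silences x y (a ω) (b ω) (d ω) ∨ Silences y x (b ω) (a ω) (d ω)) ∧
      (∃ᵐ ω ∂μ, 1 < x * a ω ∧ y * b ω ≤ x * a ω) ∧
      (∃ᵐ ω ∂μ, 1 < y * b ω ∧ x * a ω ≤ y * b ω) := by
  have hmax' : ∀ Q' P', IsPolicy μ c₂ Q' → IsPolicy μ c₁ P' →
      sumLog μ b a d Q' P' ≤ sumLog μ b a d Q P := fun Q' P' hQ' hP' => by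
    rw [sumLog_swap, sumLog_swap (P := P)]; exact hmax P' Q' hP' hQ'
  obtain ⟨x, hx, h1, i1⟩ := (isBestResponse_of_max_sumLog h hP hQ hmax).exists_eq_waterfill
    (h.isGain_gainUnder hQ.measurable hQ.nonneg) hc₁
  obtain ⟨y, hy, h2, i2⟩ := (isBestResponse_of_max_sumLog h.swap hQ hP hmax').exists_eq_waterfill
    (h.swap.isGain_gainUnder hP.measurable hP.nonneg) hc₂
  have hpos : ∀ {F : Ω → ℝ} {c : ℝ}, 0 < c → (∀ ω, 0 ≤ F ω) → ∫ ω, F ω ∂μ = c →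
      ∃ᵐ ω ∂μ, 0 < F ω := by
    intro F c hc hF hi hn
    have : F =ᵐ[μ] 0 := by
      filter_upwards [hn] with ω hω
      exact le_antisymm (not_lt.1 hω) (hF ω)
    rw [integral_congr_ae this] at hi
    simp at hi
    exact hc.ne hi
  have hfst : ∀ᵐ ω ∂μ, 0 < P ω →
      1 < x * a ω ∧ y * b ω ≤ x * a ω ∧ Silences x y (a ω) (b ω) (d ω) := by
    filter_upwards [h1, h2, hsilent, h.fst.pos, h.snd.pos] with ω e1 e2 hs ha hb hp
    have hq : Q ω = 0 := hs.resolve_left hp.ne'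
    rw [gainUnder, hq, gain_zero] at e1
    rw [hq] at e2
    exact silences_of_waterfill ha hb (h.gram_nonneg ω) hy hp
      (e1.trans (waterfill_eq_of_pos (e1 ▸ hp))) (waterfill_eq_zero_iff.1 e2.symm)
  have hsnd : ∀ᵐ ω ∂μ, 0 < Q ω →
      1 < y * b ω ∧ x * a ω ≤ y * b ω ∧ Silences y x (b ω) (a ω) (d ω) := by
    filter_upwards [h1, h2, hsilent, h.fst.pos, h.snd.pos] with ω e1 e2 hs ha hb hq
    have hp : P ω = 0 := hs.resolve_right hq.ne'
    rw [gainUnder, hp, gain_zero] at e2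
    rw [hp] at e1
    exact silences_of_waterfill hb ha (h.gram_nonneg ω) hx hq
      (e2.trans (waterfill_eq_of_pos (e2 ▸ hq))) (waterfill_eq_zero_iff.1 e1.symm)
  refine ⟨x, y, hx, hy, ?_, ?_, ?_⟩
  · filter_upwards [h1, h2, hfst, hsnd, h.fst.pos] with ω e1 e2 f1 f2 ha hxa hyb
    rcases (hP.nonneg ω).lt_or_eq with hp | hp
    · exact Or.inl (f1 hp).2.2
    rcases (hQ.nonneg ω).lt_or_eq with hq | hq
    · exact Or.inr (f2 hq).2.2
    -- If both users were silent, user 1 would see its full gain and stay silent only if $xa\le1$.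
    rw [gainUnder, ← hq, gain_zero, ← hp] at e1
    have := waterfill_eq_zero_iff.1 e1.symm
    have := mul_le_mul_of_nonneg_right this ha.le
    rw [inv_mul_cancel₀ ha.ne'] at this
    linarith
  · exact (hpos hc₁ hP.nonneg i1).mp (hfst.mono fun ω hω hp => ⟨(hω hp).1, (hω hp).2.1⟩)
  · exact (hpos hc₂ hQ.nonneg i2).mp (hsnd.mono fun ω hω hp => ⟨(hω hp).1, (hω hp).2.1⟩)

/-- Strict separation of the levels in fading states with nondegenerate Gram determinant. -/
lemma not_silences_of_eq {x y a b d : ℝ} (hd : 0 < d) (hxa : 1 < x * a)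
    (hy : 0 < y) (hxy : x * a = y * b) : ¬ Silences x y a b d := by
  unfold Silences
  intro hle
  have h1 : y * (x * (a * d) + (a * b - d)) = x * a ^ 2 + y * d * (x * a - 1) := by
    linear_combination -a * hxy
  have : 0 < y * d * (x * a - 1) := by
    have := sub_pos.2 hxa
    positivity
  linarith

end FadingMAC

open scoped RealInnerProductSpace Pointwise

/-! ### From channel vectors to gains, and null sets of fading states -/

namespace VectorMAC

open FadingMAC Filter Topology

variable {n : ℕ} (C : VectorMAC n)

/-- The channel gain of user 1, normalized by the noise variance. -/
noncomputable def gain₁ (H : FadingState n) : ℝ := ‖H.1‖ ^ 2 / C.noiseVar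

/-- The channel gain of user 2, normalized by the noise variance. -/
noncomputable def gain₂ (H : FadingState n) : ℝ := ‖H.2‖ ^ 2 / C.noiseVar

/-- The Gram determinant of the normalized channel vectors. -/
noncomputable def gram (H : FadingState n) : ℝ :=
  (‖H.1‖ ^ 2 * ‖H.2‖ ^ 2 - ⟪H.1, H.2⟫ ^ 2) / C.noiseVar ^ 2

/-- The perturbation of the identity factors through dimension two, so $\det(I+AB)=\det(I+BA)$
reduces to a $2\times2$ determinant. -/
lemma det_one_add_smul_vecMulVec_add {ι : Type*} [Fintype ι] [DecidableEq ι] (u v : ι → ℝ)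
    (p q : ℝ) :
    (1 + (p • Matrix.vecMulVec u u + q • Matrix.vecMulVec v v) : Matrix ι ι ℝ).det =
      1 + p * (u ⬝ᵥ u) + q * (v ⬝ᵥ v) + p * q * ((u ⬝ᵥ u) * (v ⬝ᵥ v) - (u ⬝ᵥ v) ^ 2) := by
  set A : Matrix ι (Fin 2) ℝ := Matrix.of fun k j => ![u k, v k] j
  set B : Matrix (Fin 2) ι ℝ := Matrix.of fun j k => ![p * u k, q * v k] j
  have hAB : p • Matrix.vecMulVec u u + q • Matrix.vecMulVec v v = A * B := by
    ext i j
    simp [A, B, Matrix.mul_apply, Matrix.vecMulVec_apply]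
    ring
  rw [hAB, Matrix.det_one_add_mul_comm, Matrix.det_fin_two]
  have e : ∀ (r : ℝ) (w z : ι → ℝ), ∑ k, r * w k * z k = r * (w ⬝ᵥ z) := fun r w z => by
    simp [dotProduct, Finset.mul_sum, mul_assoc]
  simp only [Matrix.add_apply, Matrix.mul_apply, A, B, Matrix.of_apply, Matrix.cons_val_zero,
    Matrix.cons_val_one, Matrix.one_apply_eq, e]
  rw [Matrix.one_apply_ne (by decide), Matrix.one_apply_ne (by decide), dotProduct_comm v u]
  ring

lemma dotProduct_eq_inner (u v : EuclideanSpace ℝ (Fin n)) :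
    (fun k => u k) ⬝ᵥ (fun k => v k) = ⟪u, v⟫ := by
  rw [real_inner_comm]
  simp [PiLp.inner_apply, dotProduct]

lemma det_one_add_smul (hs : 0 < C.noiseVar) (p q : ℝ) (H : FadingState n) :
    ((1 : Matrix (Fin n) (Fin n) ℝ) + C.noiseVar⁻¹ •
      (p • Matrix.vecMulVec (fun k => H.1 k) (fun k => H.1 k)
        + q • Matrix.vecMulVec (fun k => H.2 k) (fun k => H.2 k))).det =
      1 + p * C.gain₁ H + q * C.gain₂ H + p * q * C.gram H := by
  rw [smul_add, smul_smul, smul_smul, det_one_add_smul_vecMulVec_add, dotProduct_eq_inner,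
    dotProduct_eq_inner, dotProduct_eq_inner, real_inner_self_eq_norm_sq,
    real_inner_self_eq_norm_sq]
  unfold gain₁ gain₂ gram
  field_simp

lemma det_receivedCov (hs : 0 < C.noiseVar) (p q : ℝ) (H : FadingState n) :
    (C.receivedCov p q H).det = C.noiseVar ^ n *
      (1 + p * C.gain₁ H + q * C.gain₂ H + p * q * C.gram H) := by
  rw [← C.det_one_add_smul hs]
  have : C.receivedCov p q H = C.noiseVar • ((1 : Matrix (Fin n) (Fin n) ℝ) + C.noiseVar⁻¹ •
      (p • Matrix.vecMulVec (fun k => H.1 k) (fun k => H.1 k)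
        + q • Matrix.vecMulVec (fun k => H.2 k) (fun k => H.2 k))) := by
    rw [smul_add, smul_smul, mul_inv_cancel₀ hs.ne', one_smul, ← add_assoc]
    rfl
  rw [this, Matrix.det_smul, Fintype.card_fin]

lemma gram_nonneg (H : FadingState n) : 0 ≤ C.gram H := by
  refine div_nonneg (sub_nonneg.2 ?_) (sq_nonneg _)
  rw [← mul_pow]
  exact sq_le_sq.2 ((abs_real_inner_le_norm _ _).trans (le_abs_self _))

lemma gram_eq (H : FadingState n) :
    C.gain₁ H * C.gain₂ H - C.gram H = ⟪H.1, H.2⟫ ^ 2 / C.noiseVar ^ 2 := by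
  unfold gain₁ gain₂ gram
  ring

lemma gram_le (H : FadingState n) : C.gram H ≤ C.gain₁ H * C.gain₂ H := by
  rw [← sub_nonneg, gram_eq]; positivity

lemma gain₁_nonneg (hs : 0 < C.noiseVar) (H : FadingState n) : 0 ≤ C.gain₁ H := by
  unfold gain₁; positivity

lemma gain₂_nonneg (hs : 0 < C.noiseVar) (H : FadingState n) : 0 ≤ C.gain₂ H := by
  unfold gain₂; positivity

lemma continuous_gain₁ : Continuous C.gain₁ := by unfold gain₁; fun_prop

lemma continuous_gain₂ : Continuous C.gain₂ := by unfold gain₂; fun_prop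

lemma continuous_gram : Continuous C.gram := by unfold gram; fun_prop

/-- Conversion factor from natural logarithms to rates in bits per real dimension. -/
noncomputable def bitRate : ℝ := 1 / 2 / Real.log 2

lemma bitRate_pos : 0 < bitRate := by
  have := Real.log_pos one_lt_two
  unfold bitRate; positivity

lemma sumInfo_eq (hs : 0 < C.noiseVar) (P Q : FadingState n → ℝ) :
    C.sumInfo P Q = bitRate * sumLog C.law C.gain₁ C.gain₂ C.gram P Q := by
  unfold sumInfo sumLog
  rw [← integral_const_mul]
  congr 1; ext H
  rw [C.det_one_add_smul hs, Real.logb, bitRate]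
  ring

lemma rate₁_eq (hs : 0 < C.noiseVar) (D : Set (FadingState n)) {P Q : FadingState n → ℝ}
    (hP : ∀ H, 0 ≤ P H) (hQ : ∀ H, 0 ≤ Q H) :
    C.rate₁ D P Q
      = bitRate * logValue C.law (gainUnder C.gain₁ C.gain₂ C.gram (D.indicator Q)) P := by
  unfold rate₁ logValue
  rw [← integral_const_mul]
  congr 1; ext H
  have ha := C.gain₁_nonneg hs H
  have hb := C.gain₂_nonneg hs H
  have hd := C.gram_nonneg H
  have hp := hP H
  have hq := indicator_nonneg' (D := D) hQ H
  rw [C.det_receivedCov hs, C.det_receivedCov hs, Real.logb, Real.logb,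
    Real.log_mul (by positivity) (by positivity), Real.log_mul (by positivity) (by positivity),
    log_joint_gain ha hb hd hp hq, bitRate, gainUnder]
  simp only [zero_mul, add_zero]
  ring

lemma rate₂_eq (hs : 0 < C.noiseVar) (D : Set (FadingState n)) {P Q : FadingState n → ℝ}
    (hP : ∀ H, 0 ≤ P H) (hQ : ∀ H, 0 ≤ Q H) :
    C.rate₂ D P Q
      = bitRate * logValue C.law (gainUnder C.gain₂ C.gain₁ C.gram (Dᶜ.indicator P)) Q := by
  unfold rate₂ logValue
  rw [← integral_const_mul]
  congr 1; ext H
  have ha := C.gain₁_nonneg hs H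
  have hb := C.gain₂_nonneg hs H
  have hd := C.gram_nonneg H
  have hq := hQ H
  have hp := indicator_nonneg' (D := Dᶜ) hP H
  have e : 1 + Dᶜ.indicator P H * C.gain₁ H + Q H * C.gain₂ H + Dᶜ.indicator P H * Q H * C.gram H
    = 1 + Q H * C.gain₂ H + Dᶜ.indicator P H * C.gain₁ H + Q H * Dᶜ.indicator P H * C.gram H := by
    ring
  rw [C.det_receivedCov hs, C.det_receivedCov hs, Real.logb, Real.logb,
    Real.log_mul (by positivity) (by positivity), Real.log_mul (by positivity) (by positivity),
    e, log_joint_gain hb ha hd hq hp, bitRate, gainUnder]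
  simp only [zero_mul, mul_zero, add_zero]
  ring

lemma isFeasible_iff {c : ℝ} {P : FadingState n → ℝ} :
    C.IsFeasible c P ↔ IsPolicy C.law c P :=
  ⟨fun h => ⟨h.1, h.2, h.3, h.4⟩, fun h => ⟨h.1, h.2, h.3, h.4⟩⟩

lemma isNash_iff (hs : 0 < C.noiseVar) {D : Set (FadingState n)} {P Q : FadingState n → ℝ} :
    C.IsNash D P Q ↔
      IsEquilibrium C.law C.gain₁ C.gain₂ C.gram C.power₁ C.power₂ D P Q := by
  constructor
  · rintro ⟨hP, hQ, h1, h2⟩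
    refine ⟨⟨C.isFeasible_iff.1 hP, fun R hR => ?_⟩, ⟨C.isFeasible_iff.1 hQ, fun R hR => ?_⟩⟩
    · have := h1 R (C.isFeasible_iff.2 hR)
      rw [C.rate₁_eq hs D hR.nonneg hQ.nonneg, C.rate₁_eq hs D hP.nonneg hQ.nonneg] at this
      exact le_of_mul_le_mul_left this bitRate_pos
    · have := h2 R (C.isFeasible_iff.2 hR)
      rw [C.rate₂_eq hs D hP.nonneg hR.nonneg, C.rate₂_eq hs D hP.nonneg hQ.nonneg] at this
      exact le_of_mul_le_mul_left this bitRate_pos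
  · rintro ⟨⟨hP, h1⟩, ⟨hQ, h2⟩⟩
    refine ⟨C.isFeasible_iff.2 hP, C.isFeasible_iff.2 hQ, fun R hR => ?_, fun R hR => ?_⟩
    · rw [C.rate₁_eq hs D hR.nonneg hQ.nonneg, C.rate₁_eq hs D hP.nonneg hQ.nonneg]
      exact mul_le_mul_of_nonneg_left (h1 R (C.isFeasible_iff.1 hR)) bitRate_pos.le
    · rw [C.rate₂_eq hs D hP.nonneg hR.nonneg, C.rate₂_eq hs D hP.nonneg hQ.nonneg]
      exact mul_le_mul_of_nonneg_left (h2 R (C.isFeasible_iff.1 hR)) bitRate_pos.le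

/-- A measurable set that meets each open ray in at most one point is null. -/
lemma addHaar_eq_zero_of_smul_notMem {E : Type*} [NormedAddCommGroup E] [NormedSpace ℝ E]
    [FiniteDimensional ℝ E] [MeasurableSpace E] [BorelSpace E] (μ : Measure E)
    [μ.IsAddHaarMeasure] {T : Set E} (hT : MeasurableSet T)
    (hray : ∀ h ∈ T, ∀ t : ℝ, 1 < t → t • h ∉ T) : μ T = 0 := by
  have hcover : T ⊆ ⋃ R : ℕ, T ∩ Metric.closedBall 0 R := fun h hh => by
    obtain ⟨R, hR⟩ := exists_nat_ge ‖h‖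
    exact Set.mem_iUnion.2 ⟨R, hh, by simpa using hR⟩
  refine measure_mono_null hcover (measure_iUnion_null fun R => ?_)
  set B := T ∩ Metric.closedBall (0 : E) R with hB
  have hBm : MeasurableSet B := hT.inter measurableSet_closedBall
  -- The dilates of $B$ by these distinct ratios in $(1,2]$ are disjoint, lie in one ball and are no
  -- smaller than $B$. Infinitely many of them fit only if $B$ is null.
  set r : ℕ → ℝ := fun k => 1 + 1 / ((k : ℝ) + 1) with hr
  have hr1 : ∀ k, 1 ≤ r k := fun k => by
    have : 0 < 1 / ((k : ℝ) + 1) := by positivity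
    simp only [hr]; linarith
  have hr2 : ∀ k, r k ≤ 2 := fun k => by
    have : 1 / ((k : ℝ) + 1) ≤ 1 := by
      rw [div_le_one (by positivity)]
      linarith [(Nat.cast_nonneg k : (0 : ℝ) ≤ k)]
    simp only [hr]; linarith
  have hr0 : ∀ k, 0 < r k := fun k => one_pos.trans_le (hr1 k)
  have hrlt : ∀ j k, j < k → r k < r j := fun j k hjk => by
    have : (j : ℝ) < k := by exact_mod_cast hjk
    have := one_div_lt_one_div_of_lt (show (0 : ℝ) < j + 1 by positivity)
      (add_lt_add_left this 1)
    simp only [hr]; linarith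
  have hdis : ∀ j k, j < k → Disjoint (r j • B) (r k • B) := fun j k hjk => by
    rw [Set.disjoint_left]
    rintro _ ⟨h, hh, rfl⟩ ⟨h', hh', he⟩
    simp only at he
    have : (r j / r k) • h = h' := by
      rw [div_eq_inv_mul, mul_smul, ← he, inv_smul_smul₀ (hr0 k).ne']
    exact hray h hh.1 (r j / r k) ((one_lt_div (hr0 k)).2 (hrlt j k hjk)) (this ▸ hh'.1)
  have hpair : Pairwise (Function.onFun Disjoint fun k => r k • B) := fun j k hjk => by
    rcases lt_or_gt_of_ne hjk with h | h
    · exact hdis j k h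
    · exact (hdis k j h).symm
  have hsum := measure_iUnion (μ := μ) hpair fun k => hBm.const_smul_of_ne_zero (hr0 k).ne'
  have hfin : μ (⋃ k, r k • B) < ⊤ := by
    refine (measure_mono ?_).trans_lt
      (measure_closedBall_lt_top (μ := μ) (x := (0 : E)) (r := 2 * R))
    refine Set.iUnion_subset fun k => ?_
    rintro _ ⟨h, hh, rfl⟩
    have h1 : ‖h‖ ≤ R := by simpa using hh.2
    simp only [mem_closedBall_zero_iff, norm_smul, Real.norm_eq_abs, abs_of_pos (hr0 k)]
    exact mul_le_mul (hr2 k) h1 (norm_nonneg _) zero_le_two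
  by_contra hne
  have hle : ∀ k, μ B ≤ μ (r k • B) := fun k => by
    rw [Measure.addHaar_smul]
    refine le_mul_of_one_le_left zero_le ?_
    rw [ENNReal.one_le_ofReal]
    exact (one_le_pow₀ (hr1 k)).trans (le_abs_self _)
  have htop : (⊤ : ENNReal) ≤ ∑' k, μ (r k • B) := by
    rw [← ENNReal.tsum_const_eq_top_of_ne_zero (α := ℕ) hne]
    exact ENNReal.tsum_le_tsum hle
  rw [← hsum] at htop
  exact absurd hfin (not_lt.2 htop)

/-- By Fubini: for $h_1\ne0$ the slice is a hyperplane. This one null set accounts for both the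
positivity of the gains and the strict inequality $d<ab$. -/
lemma ae_inner_ne_zero (hn : 1 ≤ n) : ∀ᵐ H : FadingState n, ⟪H.1, H.2⟫ ≠ 0 := by
  have : Nonempty (Fin n) := ⟨⟨0, hn⟩⟩
  have hm : MeasurableSet {H : FadingState n | ⟪H.1, H.2⟫ = 0} :=
    (isClosed_eq (by fun_prop) continuous_const).measurableSet
  have h0 : ∀ᵐ h : EuclideanSpace ℝ (Fin n), h ≠ 0 := by
    simp [ae_iff]
  have : (volume : Measure (FadingState n)) {H | ⟪H.1, H.2⟫ = 0} = 0 := by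
    rw [show (volume : Measure (FadingState n)) = volume.prod volume from rfl,
      Measure.measure_prod_null hm]
    filter_upwards [h0] with h hh
    set S : Submodule ℝ (EuclideanSpace ℝ (Fin n)) := LinearMap.ker (innerSL ℝ h).toLinearMap
    have hS : S ≠ ⊤ := fun hS => by
      have : h ∈ S := hS ▸ Submodule.mem_top
      simp [S] at this
      exact hh this
    exact Measure.addHaar_submodule volume S hS
  simpa [ae_iff] using this

/-- Scaling $h_2$ by $t$ multiplies $a$ (here the gain of user 2) and $d$ by $t^2$ and fixes $b$.
Two solutions on one ray force the factor $ab-d-kbd$ to vanish, and then the relation equates $0$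
with a positive quantity. -/
lemma ae_not_isCoupled_swap (hn : 1 ≤ n) (hs : 0 < C.noiseVar) {x y k : ℝ} (hx : 0 < x)
    (hy : 0 < y) (hk : 0 < k) :
    ∀ᵐ H : FadingState n, ¬ IsCoupled x y k (C.gain₂ H) (C.gain₁ H) (C.gram H) := by
  have hm : MeasurableSet {H : FadingState n | ⟪H.1, H.2⟫ ≠ 0 ∧
      IsCoupled x y k (C.gain₂ H) (C.gain₁ H) (C.gram H)} := by
    have h1 := C.continuous_gain₁
    have h2 := C.continuous_gain₂
    have h3 := C.continuous_gram
    refine MeasurableSet.inter ?_ ?_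
    · exact (isOpen_ne_fun (by fun_prop) continuous_const).measurableSet
    · exact (isClosed_eq (by fun_prop) (by fun_prop)).measurableSet
  have hnull : (volume : Measure (FadingState n)) {H : FadingState n | ⟪H.1, H.2⟫ ≠ 0 ∧
      IsCoupled x y k (C.gain₂ H) (C.gain₁ H) (C.gram H)} = 0 := by
    rw [show (volume : Measure (FadingState n)) = volume.prod volume from rfl,
      Measure.measure_prod_null hm]
    refine Eventually.of_forall fun h₁ => ?_
    refine addHaar_eq_zero_of_smul_notMem volume (measurable_prodMk_left hm) ?_
    rintro h₂ ⟨hin, hc⟩ t ht ⟨-, hc'⟩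
    simp only at hin hc hc'
    have e2 : C.gain₂ (h₁, t • h₂) = t ^ 2 * C.gain₂ (h₁, h₂) := by
      simp [gain₂, norm_smul, mul_pow, mul_div_assoc]
    have e1 : C.gain₁ (h₁, t • h₂) = C.gain₁ (h₁, h₂) := rfl
    have ed : C.gram (h₁, t • h₂) = t ^ 2 * C.gram (h₁, h₂) := by
      simp [gram, norm_smul, inner_smul_right, mul_pow]
      ring
    have hg := C.gram_eq (h₁, h₂)
    have hb : 0 < C.gain₁ (h₁, h₂) := by
      have : h₁ ≠ 0 := fun h => hin (by simp [h])
      unfold gain₁; positivity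
    have hd := C.gram_nonneg (h₁, h₂)
    rw [e1, e2, ed] at hc'
    unfold IsCoupled at hc hc'
    set a := C.gain₂ (h₁, h₂)
    set b := C.gain₁ (h₁, h₂)
    set d := C.gram (h₁, h₂)
    have hc2 : 0 < a * b - d := by
      rw [mul_comm, hg]
      have : ⟪h₁, h₂⟫ ≠ 0 := hin
      positivity
    obtain ⟨X, hX⟩ : ∃ X, X = y * (b * d) + (a * b - d) := ⟨_, rfl⟩
    obtain ⟨Y, hY⟩ : ∃ Y, Y = (a * b - d) - k * (b * d) := ⟨_, rfl⟩
    have hX0 : 0 < X := by rw [hX]; positivity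
    have ht2 : 1 < t ^ 2 := one_lt_pow₀ ht two_ne_zero
    have f1 : (x * X - y * b ^ 2) * Y = k * b ^ 2 * X := by rw [hX, hY]; exact hc
    have f2 : t ^ 2 * ((x * (t ^ 2 * X) - y * b ^ 2) * Y) = t ^ 2 * (k * b ^ 2 * X) := by
      rw [hX, hY]; linear_combination hc'
    have f3 := mul_left_cancel₀ (by positivity) f2
    have f4 : x * X * (t ^ 2 - 1) * Y = 0 := by linear_combination f3 - f1
    have f5 : Y = 0 := by
      refine (mul_eq_zero.1 f4).resolve_left ?_
      have := sub_pos.2 ht2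
      positivity
    rw [f5, mul_zero] at f1
    have : 0 < k * b ^ 2 * X := by positivity
    linarith
  have : ∀ᵐ H : FadingState n, ¬ (⟪H.1, H.2⟫ ≠ 0 ∧
      IsCoupled x y k (C.gain₂ H) (C.gain₁ H) (C.gram H)) := by
    simpa only [ae_iff, not_not] using hnull
  filter_upwards [this, ae_inner_ne_zero hn] with H h1 h2 h3
  exact h1 ⟨h2, h3⟩

lemma ae_not_isCoupled (hn : 1 ≤ n) (hs : 0 < C.noiseVar) {x y k : ℝ} (hx : 0 < x)
    (hy : 0 < y) (hk : 0 < k) :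
    ∀ᵐ H : FadingState n, ¬ IsCoupled x y k (C.gain₁ H) (C.gain₂ H) (C.gram H) := by
  have hmp : MeasurePreserving (Prod.swap : FadingState n → FadingState n) volume volume :=
    Measure.measurePreserving_swap
  filter_upwards [hmp.quasiMeasurePreserving.ae (C.ae_not_isCoupled_swap hn hs hx hy hk)] with H hH
  have : C.gram H.swap = C.gram H := by
    simp [gram, real_inner_comm, mul_comm]
  rwa [this] at hH

lemma integrable_log_one_add_div {μ : Measure (FadingState n)} [IsFiniteMeasure μ]
    {f : FadingState n → ℝ} {s : ℝ} (hs : 0 < s) (hf : Measurable f) (hf0 : ∀ H, 0 ≤ f H)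
    (hi : Integrable (fun H => Real.log (1 + f H)) μ) :
    Integrable (fun H => Real.log (1 + f H / s)) μ := by
  refine (hi.add (integrable_const (Real.log (1 + s⁻¹)))).mono'
    ((hf.div_const s).const_add 1).log.aestronglyMeasurable (Eventually.of_forall fun H => ?_)
  have h0 := hf0 H
  rw [Real.norm_eq_abs, abs_of_nonneg (log_one_add_nonneg (by positivity))]
  exact log_one_add_mul_le h0 (inv_nonneg.2 hs.le)

lemma isGainPair (hn : 1 ≤ n) [IsProbabilityMeasure C.law] (hdensity : C.law ≪ volume)
    (hlog₁ : Integrable (fun H : FadingState n => Real.log (1 + ‖H.1‖ ^ 2)) C.law)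
    (hlog₂ : Integrable (fun H : FadingState n => Real.log (1 + ‖H.2‖ ^ 2)) C.law)
    (hs : 0 < C.noiseVar) : IsGainPair C.law C.gain₁ C.gain₂ C.gram := by
  have hin := hdensity.ae_le (ae_inner_ne_zero hn)
  refine ⟨⟨C.continuous_gain₁.measurable, C.gain₁_nonneg hs, ?_,
      integrable_log_one_add_div hs (by fun_prop) (fun _ => sq_nonneg _) hlog₁⟩,
    ⟨C.continuous_gain₂.measurable, C.gain₂_nonneg hs, ?_,
      integrable_log_one_add_div hs (by fun_prop) (fun _ => sq_nonneg _) hlog₂⟩,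
    C.continuous_gram.measurable, C.gram_nonneg, C.gram_le⟩
  · filter_upwards [hin] with H hH
    have : H.1 ≠ 0 := fun h => hH (by simp [h])
    unfold gain₁; positivity
  · filter_upwards [hin] with H hH
    have : H.2 ≠ 0 := fun h => hH (by simp [h])
    unfold gain₂; positivity

lemma ae_gram_lt (hn : 1 ≤ n) (hdensity : C.law ≪ volume) (hs : 0 < C.noiseVar) :
    ∀ᵐ H ∂C.law, C.gram H < C.gain₁ H * C.gain₂ H := by
  filter_upwards [hdensity.ae_le (ae_inner_ne_zero hn)] with H hH
  rw [← sub_pos, gram_eq]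
  positivity

end VectorMAC

namespace FadingMAC

variable {Ω : Type*} {a b d P : Ω → ℝ}

lemma gainUnder_indicator_empty : gainUnder a b d ((∅ : Set Ω).indicator P) = a := by
  funext ω; simp [gainUnder, gain_zero]

lemma gainUnder_indicator_compl_univ : gainUnder a b d ((Set.univ : Set Ω)ᶜ.indicator P) = a := by
  funext ω; simp [gainUnder, gain_zero]

lemma logValue_nonneg [MeasurableSpace Ω] {μ : Measure Ω} {g : Ω → ℝ} (hg : ∀ ω, 0 ≤ g ω)
    (hP : ∀ ω, 0 ≤ P ω) : 0 ≤ logValue μ g P :=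
  integral_nonneg fun ω => log_one_add_nonneg (mul_nonneg (hP ω) (hg ω))

lemma sumLog_congr [MeasurableSpace Ω] {μ : Measure Ω} {P' Q Q' : Ω → ℝ} (hP : P =ᵐ[μ] P')
    (hQ : Q =ᵐ[μ] Q') : sumLog μ a b d P Q = sumLog μ a b d P' Q' :=
  integral_congr_ae (by filter_upwards [hP, hQ] with ω h1 h2; simp [h1, h2])

end FadingMAC

/-! ### Connected support excludes time sharing -/

namespace VectorMAC

open FadingMAC Filter Topology

variable {n : ℕ} (C : VectorMAC n)

/-- With two dimensions at hand, a vector can be moved along its sphere, within an open set, so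
that it is not parallel to a given vector. -/
lemma exists_mem_norm_eq_inner_sq_lt (hn : 2 ≤ n) {U : Set (EuclideanSpace ℝ (Fin n))}
    (hU : IsOpen U) {h w : EuclideanSpace ℝ (Fin n)} (hh : h ∈ U) (h0 : h ≠ 0) (w0 : w ≠ 0) :
    ∃ h' ∈ U, ‖h'‖ = ‖h‖ ∧ ⟪h', w⟫ ^ 2 < ‖h'‖ ^ 2 * ‖w‖ ^ 2 := by
  have hcs : ∀ u : EuclideanSpace ℝ (Fin n), u ≠ 0 → ¬ ⟪u, w⟫ ^ 2 < ‖u‖ ^ 2 * ‖w‖ ^ 2 →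
      ∃ r : ℝ, r ≠ 0 ∧ w = r • u := fun u hu hlt => by
    refine (norm_inner_eq_norm_iff (𝕜 := ℝ) hu w0).1
      (le_antisymm (norm_inner_le_norm u w) ?_)
    rw [not_lt, ← mul_pow, ← sq_abs ⟪u, w⟫] at hlt
    exact (abs_le_of_sq_le_sq' hlt (abs_nonneg _)).2
  by_cases hlt : ⟪h, w⟫ ^ 2 < ‖h‖ ^ 2 * ‖w‖ ^ 2
  · exact ⟨h, hh, rfl, hlt⟩
  obtain ⟨r, hr, hwr⟩ := hcs h h0 hlt
  obtain ⟨v, hv, v0⟩ : ∃ v ∈ (Submodule.span ℝ {h})ᗮ, v ≠ 0 := by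
    refine Submodule.exists_mem_ne_zero_of_ne_bot fun hbot => ?_
    have := (Submodule.span ℝ {h}).finrank_add_finrank_orthogonal
    rw [hbot, finrank_bot, finrank_span_singleton h0, finrank_euclideanSpace_fin] at this
    omega
  have hhv : ⟪h, v⟫ = 0 := Submodule.mem_orthogonal_singleton_iff_inner_right.1 hv
  have hne : ∀ ε : ℝ, h + ε • v ≠ 0 := fun ε he => by
    have : ⟪h, h + ε • v⟫ = 0 := by rw [he, inner_zero_right]
    rw [inner_add_right, inner_smul_right, hhv, mul_zero, add_zero] at this
    exact h0 (inner_self_eq_zero.1 this)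
  -- A path on the sphere through $h$ towards an orthogonal direction $v$. If $w$ were parallel both
  -- to $h$ and to a nearby point of the path, $\langle v,w\rangle$ would be both zero and nonzero.
  set γ : ℝ → EuclideanSpace ℝ (Fin n) := fun ε => (‖h‖ / ‖h + ε • v‖) • (h + ε • v) with hγ
  have hγc : Continuous γ := by
    have hc : Continuous fun ε : ℝ => h + ε • v := by fun_prop
    exact (continuous_const.div hc.norm fun ε => norm_ne_zero_iff.2 (hne ε)).smul hc
  have hγ0 : γ 0 = h := by
    simp [hγ, div_self (norm_ne_zero_iff.2 h0)]
  have hev : ∀ᶠ ε in 𝓝[≠] (0 : ℝ), γ ε ∈ U :=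
    (hγc.continuousAt.eventually (by rw [hγ0]; exact hU.mem_nhds hh)).filter_mono
      nhdsWithin_le_nhds
  obtain ⟨ε, hε, hε0⟩ := (hev.and self_mem_nhdsWithin).exists
  have hε0 : ε ≠ 0 := hε0
  have hnorm : ‖γ ε‖ = ‖h‖ := by
    simp only [hγ, norm_smul, norm_div, norm_norm]
    exact div_mul_cancel₀ _ (norm_ne_zero_iff.2 (hne ε))
  refine ⟨γ ε, hε, hnorm, ?_⟩
  by_contra hnlt
  obtain ⟨t, ht, hwt⟩ := hcs (γ ε) (norm_ne_zero_iff.1 (hnorm ▸ norm_ne_zero_iff.2 h0)) hnlt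
  have e1 : ⟪v, w⟫ = 0 := by
    rw [hwr, inner_smul_right, real_inner_comm, hhv, mul_zero]
  have e2 : ⟪v, w⟫ = t * (‖h‖ / ‖h + ε • v‖) * (ε * ‖v‖ ^ 2) := by
    rw [hwt]
    simp only [hγ, inner_smul_right, inner_add_right, real_inner_self_eq_norm_sq]
    rw [real_inner_comm, hhv]
    ring
  have : t * (‖h‖ / ‖h + ε • v‖) * (ε * ‖v‖ ^ 2) ≠ 0 := by
    have := norm_ne_zero_iff.2 h0
    have := norm_ne_zero_iff.2 v0
    have := norm_ne_zero_iff.2 (hne ε)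
    positivity
  exact this (e2 ▸ e1)

lemma isOpen_not_silences {x y : ℝ} :
    IsOpen {H : FadingState n | 1 < x * C.gain₁ H ∧ 1 < y * C.gain₂ H ∧
      ¬ Silences x y (C.gain₁ H) (C.gain₂ H) (C.gram H) ∧
      ¬ Silences y x (C.gain₂ H) (C.gain₁ H) (C.gram H)} := by
  have h1 := C.continuous_gain₁
  have h2 := C.continuous_gain₂
  have h3 := C.continuous_gram
  simp only [Silences, not_le]
  refine IsOpen.and ?_ (IsOpen.and ?_ (IsOpen.and ?_ ?_)) <;>
    exact isOpen_lt (by fun_prop) (by fun_prop)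

/-- If the fading vectors range over a product of connected open sets, then both users have an
incentive to transmit on a nonnegligible set of fading states. -/
lemma not_silences_of_connected (hn : 2 ≤ n) (hs : 0 < C.noiseVar)
    (hsupp : C.HasConnectedProductSupport) {x y : ℝ} (hx : 0 < x) (hy : 0 < y)
    (h1 : ∃ᵐ H ∂C.law, 1 < x * C.gain₁ H ∧ y * C.gain₂ H ≤ x * C.gain₁ H)
    (h2 : ∃ᵐ H ∂C.law, 1 < y * C.gain₂ H ∧ x * C.gain₁ H ≤ y * C.gain₂ H) :
    ¬ ∀ᵐ H ∂C.law, 1 < x * C.gain₁ H → 1 < y * C.gain₂ H →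
      Silences x y (C.gain₁ H) (C.gain₂ H) (C.gram H) ∨
      Silences y x (C.gain₂ H) (C.gain₁ H) (C.gram H) := by
  intro hall
  obtain ⟨U₁, U₂, hU₁, hU₁c, hU₂, hU₂c, hnull, habs⟩ := hsupp
  have hmem : ∀ᵐ H ∂C.law, H ∈ U₁ ×ˢ U₂ := by
    rw [ae_iff]; exact hnull
  obtain ⟨H, ⟨hH1, hHle⟩, hHU⟩ := (h1.and_eventually hmem).exists
  obtain ⟨K, ⟨hK1, hKle⟩, hKU⟩ := (h2.and_eventually hmem).exists
  set f : EuclideanSpace ℝ (Fin n) → ℝ := fun h => x * (‖h‖ ^ 2 / C.noiseVar) with hf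
  set g : EuclideanSpace ℝ (Fin n) → ℝ := fun h => y * (‖h‖ ^ 2 / C.noiseVar) with hg
  have hfc : Continuous f := by fun_prop
  have hgc : Continuous g := by fun_prop
  have hfa : ∀ H : FadingState n, x * C.gain₁ H = f H.1 := fun _ => rfl
  have hgb : ∀ H : FadingState n, y * C.gain₂ H = g H.2 := fun _ => rfl
  rw [hfa] at hH1
  rw [hgb] at hK1
  rw [hfa, hgb] at hHle hKle
  -- The difference $f-g$ changes sign between $H$ and $K$. Only one coordinate is moved, the other
  -- staying where its level is already above $1$: $h_1$ moves if $g(K_2)\le f(H_1)$, otherwise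
  -- $h_2$.
  obtain ⟨u, hu, v, hv, huv, hu1⟩ : ∃ u ∈ U₁, ∃ v ∈ U₂, f u = g v ∧ 1 < f u := by
    rcases le_total (g K.2) (f H.1) with hle | hle
    · obtain ⟨u, hu, he⟩ := hU₁c.isPreconnected.intermediate_value hKU.1 hHU.1 hfc.continuousOn
        ⟨hKle, hle⟩
      exact ⟨u, hu, K.2, hKU.2, he, he ▸ hK1⟩
    · obtain ⟨v, hv, he⟩ := hU₂c.isPreconnected.intermediate_value hHU.2 hKU.2 hgc.continuousOn
        ⟨hHle, hle⟩
      exact ⟨H.1, hHU.1, v, hv, he.symm, hH1⟩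
  have hu0 : u ≠ 0 := fun h => by
    rw [h] at hu1; simp [hf] at hu1; linarith
  have hv0 : v ≠ 0 := fun h => by
    rw [huv, h] at hu1; simp [hg] at hu1; linarith
  obtain ⟨u', hu', hnorm, hlt⟩ := exists_mem_norm_eq_inner_sq_lt hn hU₁ hu hu0 hv0
  have hfu : f u' = f u := by simp only [hf, hnorm]
  have hgram : 0 < C.gram (u', v) := div_pos (sub_pos.2 hlt) (by positivity)
  have hxy : x * C.gain₁ (u', v) = y * C.gain₂ (u', v) := by
    rw [hfa, hgb]; exact hfu.trans huv
  have hx1 : 1 < x * C.gain₁ (u', v) := by rw [hfa]; exact hfu ▸ hu1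
  set O := {H : FadingState n | 1 < x * C.gain₁ H ∧ 1 < y * C.gain₂ H ∧
      ¬ Silences x y (C.gain₁ H) (C.gain₂ H) (C.gram H) ∧
      ¬ Silences y x (C.gain₂ H) (C.gain₁ H) (C.gram H)} with hO
  have hmemO : (u', v) ∈ O := ⟨hx1, hxy ▸ hx1, not_silences_of_eq hgram hx1 hy hxy,
    not_silences_of_eq hgram (hxy ▸ hx1) hx hxy.symm⟩
  have hopen : IsOpen (O ∩ U₁ ×ˢ U₂) := C.isOpen_not_silences.inter (hU₁.prod hU₂)
  -- The law gives no mass to states where neither user silences the other, and it dominates volume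
  -- on the support; an open null set is empty.
  have hvol : (volume : Measure (FadingState n)) (O ∩ U₁ ×ˢ U₂) = 0 := by
    rw [← Measure.restrict_apply C.isOpen_not_silences.measurableSet]
    refine habs (measure_mono_null ?_ (ae_iff.1 hall))
    rintro H ⟨a1, a2, a3, a4⟩ hsil
    exact (hsil a1 a2).elim a3 a4
  have hempty := (hopen.measure_eq_zero_iff volume).1 hvol
  exact (Set.eq_empty_iff_forall_notMem.1 hempty (u', v)) ⟨hmemO, hu', hv⟩

/-! ### Rates, the capacity region and its distinguished points -/

section rates

variable {C} {P Q : FadingState n → ℝ}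

lemma rate_add_rate (hs : 0 < C.noiseVar) (h : IsGainPair C.law C.gain₁ C.gain₂ C.gram)
    {D : Set (FadingState n)} (hD : MeasurableSet D) {c₁ c₂ : ℝ}
    (hP : IsPolicy C.law c₁ P) (hQ : IsPolicy C.law c₂ Q) :
    C.rate₁ D P Q + C.rate₂ D P Q = C.sumInfo P Q := by
  rw [C.rate₁_eq hs D hP.nonneg hQ.nonneg, C.rate₂_eq hs D hP.nonneg hQ.nonneg, C.sumInfo_eq hs,
    ← mul_add, logValue_add_logValue h hD hP hQ]

lemma rate_mem_capacityRegion (hs : 0 < C.noiseVar)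
    (h : IsGainPair C.law C.gain₁ C.gain₂ C.gram) {D : Set (FadingState n)}
    (hD : MeasurableSet D) (hP : IsPolicy C.law C.power₁ P) (hQ : IsPolicy C.law C.power₂ Q) :
    (C.rate₁ D P Q, C.rate₂ D P Q) ∈ C.capacityRegion := by
  have g1 := h.isGain_indicator hD hQ.measurable hQ.nonneg
  have g2 := h.swap.isGain_indicator hD.compl hP.measurable hP.nonneg
  have l1 := logValue_mono_gain g1 h.fst (Eventually.of_forall fun H =>
    gain_le (h.snd.nonneg H) (h.gram_le H) (indicator_nonneg' hQ.nonneg H)) hP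
  have l2 := logValue_mono_gain g2 h.snd (Eventually.of_forall fun H =>
    gain_le (h.fst.nonneg H) (h.swap.gram_le H) (indicator_nonneg' hP.nonneg H)) hQ
  refine ⟨?_, ?_, P, Q, C.isFeasible_iff.2 hP, C.isFeasible_iff.2 hQ, ?_, ?_,
    (rate_add_rate hs h hD hP hQ).le⟩
  · rw [C.rate₁_eq hs D hP.nonneg hQ.nonneg]
    exact mul_nonneg bitRate_pos.le (logValue_nonneg g1.nonneg hP.nonneg)
  · rw [C.rate₂_eq hs D hP.nonneg hQ.nonneg]
    exact mul_nonneg bitRate_pos.le (logValue_nonneg g2.nonneg hQ.nonneg)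
  · rw [C.rate₁_eq hs D hP.nonneg hQ.nonneg, C.sumInfo_eq hs, sumLog_zero_right]
    exact mul_le_mul_of_nonneg_left l1 bitRate_pos.le
  · rw [C.rate₂_eq hs D hP.nonneg hQ.nonneg, C.sumInfo_eq hs, sumLog_zero_left]
    exact mul_le_mul_of_nonneg_left l2 bitRate_pos.le

/-- The sum of the rates is the joint information whatever the decoding order, so optimality depends
on the policies only. They need not form an equilibrium, so the lemma also yields existence of
maximum sum-rate points. -/
lemma isMaxSumRatePoint_iff (hs : 0 < C.noiseVar) (h : IsGainPair C.law C.gain₁ C.gain₂ C.gram)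
    {D : Set (FadingState n)} (hD : MeasurableSet D)
    (hP : IsPolicy C.law C.power₁ P) (hQ : IsPolicy C.law C.power₂ Q) :
    C.IsMaxSumRatePoint (C.rate₁ D P Q, C.rate₂ D P Q) ↔
      ∀ P' Q', IsPolicy C.law C.power₁ P' → IsPolicy C.law C.power₂ Q' →
        sumLog C.law C.gain₁ C.gain₂ C.gram P' Q' ≤ sumLog C.law C.gain₁ C.gain₂ C.gram P Q := by
  constructor
  · rintro ⟨-, hmax⟩ P' Q' hP' hQ'
    have := hmax _ (rate_mem_capacityRegion hs h hD hP' hQ')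
    simp only at this
    rw [rate_add_rate hs h hD hP' hQ', rate_add_rate hs h hD hP hQ, C.sumInfo_eq hs,
      C.sumInfo_eq hs] at this
    exact le_of_mul_le_mul_left this bitRate_pos
  · refine fun hmax => ⟨rate_mem_capacityRegion hs h hD hP hQ, ?_⟩
    rintro s ⟨-, -, P', Q', hP', hQ', -, -, hle⟩
    simp only
    rw [rate_add_rate hs h hD hP hQ]
    refine hle.trans ?_
    rw [C.sumInfo_eq hs, C.sumInfo_eq hs]
    exact mul_le_mul_of_nonneg_left
      (hmax P' Q' (C.isFeasible_iff.1 hP') (C.isFeasible_iff.1 hQ')) bitRate_pos.le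

/-- The equilibrium at which user 2 is always decoded first is a corner point. -/
lemma isCornerPoint₁_of_isNash [IsProbabilityMeasure C.law] (hs : 0 < C.noiseVar)
    (hc : 0 < C.power₁) (h : IsGainPair C.law C.gain₁ C.gain₂ C.gram)
    (hE : C.IsNash ∅ P Q) : C.IsCornerPoint₁ (C.rate₁ ∅ P Q, C.rate₂ ∅ P Q) := by
  obtain ⟨hB1, hB2⟩ := (C.isNash_iff hs).1 hE
  rw [gainUnder_indicator_empty] at hB1
  have hP := hB1.isPolicy
  have hQ := hB2.isPolicy
  refine ⟨rate_mem_capacityRegion hs h MeasurableSet.empty hP hQ, ?_⟩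
  rintro s ⟨-, -, P', Q', hP', hQ', hle, -, hsum⟩
  have hP' := C.isFeasible_iff.1 hP'
  have hQ' := C.isFeasible_iff.1 hQ'
  have hr1 : C.rate₁ ∅ P Q = bitRate * logValue C.law C.gain₁ P := by
    rw [C.rate₁_eq hs _ hP.nonneg hQ.nonneg, gainUnder_indicator_empty]
  rw [C.sumInfo_eq hs, sumLog_zero_right] at hle
  simp only
  refine ⟨hle.trans ?_, fun heq => ?_⟩
  · rw [hr1]
    exact mul_le_mul_of_nonneg_left (hB1.le P' hP') bitRate_pos.le
  · have hPP' : P' =ᵐ[C.law] P := by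
      refine hB1.ae_eq_of_le h.fst hc hP' ?_
      rw [heq, hr1] at hle
      exact le_of_mul_le_mul_left hle bitRate_pos
    -- Since $P'$ agrees with $P$ almost surely, the sum bound splits into the fixed rate of user 1
    -- and the rate of $Q'$ against $P$, which the best response $Q$ dominates.
    have e : C.sumInfo P' Q' = C.rate₁ ∅ P Q + C.rate₂ ∅ P Q' := by
      have : C.rate₁ ∅ P Q = C.rate₁ ∅ P Q' := by
        rw [hr1, C.rate₁_eq hs _ hP.nonneg hQ'.nonneg, gainUnder_indicator_empty]
      rw [this, rate_add_rate hs h MeasurableSet.empty hP hQ', C.sumInfo_eq hs, C.sumInfo_eq hs,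
        sumLog_congr hPP' Filter.EventuallyEq.rfl]
    have := hE.best₂ Q' (C.isFeasible_iff.2 hQ')
    linarith

/-- The equilibrium at which user 1 is always decoded first is a corner point. -/
lemma isCornerPoint₂_of_isNash [IsProbabilityMeasure C.law] (hs : 0 < C.noiseVar)
    (hc : 0 < C.power₂) (h : IsGainPair C.law C.gain₁ C.gain₂ C.gram)
    (hE : C.IsNash Set.univ P Q) :
    C.IsCornerPoint₂ (C.rate₁ Set.univ P Q, C.rate₂ Set.univ P Q) := by
  obtain ⟨hB1, hB2⟩ := (C.isNash_iff hs).1 hE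
  rw [gainUnder_indicator_compl_univ] at hB2
  have hP := hB1.isPolicy
  have hQ := hB2.isPolicy
  refine ⟨rate_mem_capacityRegion hs h MeasurableSet.univ hP hQ, ?_⟩
  rintro s ⟨-, -, P', Q', hP', hQ', -, hle, hsum⟩
  have hP' := C.isFeasible_iff.1 hP'
  have hQ' := C.isFeasible_iff.1 hQ'
  have hr2 : C.rate₂ Set.univ P Q = bitRate * logValue C.law C.gain₂ Q := by
    rw [C.rate₂_eq hs _ hP.nonneg hQ.nonneg, gainUnder_indicator_compl_univ]
  rw [C.sumInfo_eq hs, sumLog_zero_left] at hle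
  simp only
  refine ⟨hle.trans ?_, fun heq => ?_⟩
  · rw [hr2]
    exact mul_le_mul_of_nonneg_left (hB2.le Q' hQ') bitRate_pos.le
  · have hQQ' : Q' =ᵐ[C.law] Q := by
      refine hB2.ae_eq_of_le h.snd hc hQ' ?_
      rw [heq, hr2] at hle
      exact le_of_mul_le_mul_left hle bitRate_pos
    have e : C.sumInfo P' Q' = C.rate₁ Set.univ P' Q + C.rate₂ Set.univ P Q := by
      have : C.rate₂ Set.univ P Q = C.rate₂ Set.univ P' Q := by
        rw [hr2, C.rate₂_eq hs _ hP'.nonneg hQ.nonneg, gainUnder_indicator_compl_univ]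
      rw [this, rate_add_rate hs h MeasurableSet.univ hP' hQ, C.sumInfo_eq hs, C.sumInfo_eq hs,
        sumLog_congr Filter.EventuallyEq.rfl hQQ']
    have := hE.best₁ P' (C.isFeasible_iff.2 hP')
    linarith

/-- The low-level game has exactly one admissible equilibrium. -/
theorem exists_unique_isAdmissibleNash [IsProbabilityMeasure C.law] (hs : 0 < C.noiseVar)
    (hc₁ : 0 < C.power₁) (hc₂ : 0 < C.power₂) (h : IsGainPair C.law C.gain₁ C.gain₂ C.gram)
    {D : Set (FadingState n)} (hD : MeasurableSet D) :
    ∃ P₁ P₂, C.IsAdmissibleNash D P₁ P₂ ∧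
      ∀ Q₁ Q₂, C.IsAdmissibleNash D Q₁ Q₂ → Q₁ =ᵐ[C.law] P₁ ∧ Q₂ =ᵐ[C.law] P₂ := by
  obtain ⟨P₁, P₂, hP, hdom⟩ := exists_dominating_equilibrium h hD hc₁ hc₂
  have hN := (C.isNash_iff hs).2 hP
  have hdom' : ∀ Q₁ Q₂, C.IsNash D Q₁ Q₂ →
      C.rate₁ D Q₁ Q₂ ≤ C.rate₁ D P₁ P₂ ∧ C.rate₂ D Q₁ Q₂ ≤ C.rate₂ D P₁ P₂ ∧
      (C.rate₁ D P₁ P₂ ≤ C.rate₁ D Q₁ Q₂ → Q₁ =ᵐ[C.law] P₁) ∧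
      (C.rate₂ D P₁ P₂ ≤ C.rate₂ D Q₁ Q₂ → Q₂ =ᵐ[C.law] P₂) := by
    intro Q₁ Q₂ hQ
    have n1 := hQ.feasible₁.nonneg
    have n2 := hQ.feasible₂.nonneg
    rw [C.rate₁_eq hs D n1 n2, C.rate₂_eq hs D n1 n2,
      C.rate₁_eq hs D hN.feasible₁.nonneg hN.feasible₂.nonneg,
      C.rate₂_eq hs D hN.feasible₁.nonneg hN.feasible₂.nonneg]
    simp only [mul_le_mul_iff_right₀ bitRate_pos]
    exact hdom Q₁ Q₂ ((C.isNash_iff hs).1 hQ)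
  refine ⟨P₁, P₂, ⟨hN, ?_⟩, fun Q₁ Q₂ hQ => ?_⟩
  · rintro ⟨Q₁, Q₂, hQ, -, -, hlt | hlt⟩
    · exact absurd hlt (not_lt.2 (hdom' Q₁ Q₂ hQ).1)
    · exact absurd hlt (not_lt.2 (hdom' Q₁ Q₂ hQ).2.1)
  · obtain ⟨l1, l2, e1, e2⟩ := hdom' Q₁ Q₂ hQ.1
    have hno := hQ.2
    refine ⟨e1 (not_lt.1 fun hlt => ?_), e2 (not_lt.1 fun hlt => ?_)⟩
    · exact hno ⟨P₁, P₂, hN, l1, l2, Or.inl hlt⟩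
    · exact hno ⟨P₁, P₂, hN, l1, l2, Or.inr hlt⟩

end rates

end VectorMAC

theorem mainTheorem7 {n : ℕ} (hn : 1 ≤ n) (C : VectorMAC n)
    (hprob : IsProbabilityMeasure C.law)
    (hdensity : C.law ≪ volume)
    (hlog₁ : Integrable (fun H : FadingState n => Real.log (1 + ‖H.1‖ ^ 2)) C.law)
    (hlog₂ : Integrable (fun H : FadingState n => Real.log (1 + ‖H.2‖ ^ 2)) C.law)
    (hnoise : 0 < C.noiseVar) (hpower₁ : 0 < C.power₁) (hpower₂ : 0 < C.power₂) :
    -- for every base-station strategy, a unique (almost surely) admissible Nash equilibrium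
    (∀ D : Set (FadingState n), MeasurableSet D →
      ∃ P₁ P₂, C.IsAdmissibleNash D P₁ P₂ ∧
        ∀ Q₁ Q₂, C.IsAdmissibleNash D Q₁ Q₂ → Q₁ =ᵐ[C.law] P₁ ∧ Q₂ =ᵐ[C.law] P₂) ∧
    -- both corner points are achieved
    (∃ r ∈ C.stackelbergRegion, C.IsCornerPoint₁ r) ∧
    (∃ r ∈ C.stackelbergRegion, C.IsCornerPoint₂ r) ∧
    -- the maximum sum-rate is attained in the capacity region
    (∃ r, C.IsMaxSumRatePoint r) ∧
    -- an equilibrium of the game could attain it only by time sharing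
    (∀ (D : Set (FadingState n)) (P₁ P₂ : FadingState n → ℝ), MeasurableSet D →
      C.IsAdmissibleNash D P₁ P₂ →
      C.IsMaxSumRatePoint (C.rate₁ D P₁ P₂, C.rate₂ D P₁ P₂) →
      ∀ᵐ H ∂C.law, P₁ H = 0 ∨ P₂ H = 0) ∧
    -- with at least two antennas and non-degenerate fading it is never attained by the game
    (2 ≤ n → C.HasConnectedProductSupport →
      ∀ r ∈ C.stackelbergRegion, ¬ C.IsMaxSumRatePoint r) := by
  have h := C.isGainPair hn hdensity hlog₁ hlog₂ hnoise
  have hsilent : ∀ (D : Set (FadingState n)) (P₁ P₂ : FadingState n → ℝ), MeasurableSet D →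
      C.IsAdmissibleNash D P₁ P₂ →
      C.IsMaxSumRatePoint (C.rate₁ D P₁ P₂, C.rate₂ D P₁ P₂) →
      ∀ᵐ H ∂C.law, P₁ H = 0 ∨ P₂ H = 0 := by
    intro D P₁ P₂ hD hN hmax
    have hE := (C.isNash_iff hnoise).1 hN.1
    exact FadingMAC.ae_silent_of_max_sumLog h hpower₁ hpower₂ (C.ae_gram_lt hn hdensity hnoise)
      (fun x y k hx hy hk => hdensity.ae_le (C.ae_not_isCoupled hn hnoise hx hy hk))
      (fun x y k hx hy hk => hdensity.ae_le (C.ae_not_isCoupled_swap hn hnoise hx hy hk)) hD hE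
      ((VectorMAC.isMaxSumRatePoint_iff hnoise h hD hE.best₁.isPolicy hE.best₂.isPolicy).1 hmax)
  refine ⟨fun D hD => VectorMAC.exists_unique_isAdmissibleNash hnoise hpower₁ hpower₂ h hD,
    ?_, ?_, ?_, hsilent, ?_⟩
  · obtain ⟨P, Q, hPQ, -⟩ := VectorMAC.exists_unique_isAdmissibleNash hnoise hpower₁ hpower₂ h
      MeasurableSet.empty
    exact ⟨_, ⟨∅, P, Q, MeasurableSet.empty, hPQ, rfl⟩,
      VectorMAC.isCornerPoint₁_of_isNash hnoise hpower₁ h hPQ.1⟩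
  · obtain ⟨P, Q, hPQ, -⟩ := VectorMAC.exists_unique_isAdmissibleNash hnoise hpower₁ hpower₂ h
      MeasurableSet.univ
    exact ⟨_, ⟨Set.univ, P, Q, MeasurableSet.univ, hPQ, rfl⟩,
      VectorMAC.isCornerPoint₂_of_isNash hnoise hpower₂ h hPQ.1⟩
  · obtain ⟨P, Q, hP, hQ, hmax⟩ := FadingMAC.exists_max_sumLog h hpower₁ hpower₂
    -- The empty set is an arbitrary choice: any decoding order splits the maximal joint information
    -- into a rate pair of the region.
    exact ⟨_, (VectorMAC.isMaxSumRatePoint_iff hnoise h MeasurableSet.empty hP hQ).2 hmax⟩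
  · rintro hn2 hsupp r ⟨D, P, Q, hD, hN, rfl⟩ hmax
    have hE := (C.isNash_iff hnoise).1 hN.1
    obtain ⟨x, y, hx, hy, hall, h1, h2⟩ := FadingMAC.exists_levels_of_silent h hpower₁ hpower₂
      hE.best₁.isPolicy hE.best₂.isPolicy
      ((VectorMAC.isMaxSumRatePoint_iff hnoise h hD hE.best₁.isPolicy hE.best₂.isPolicy).1 hmax)
      (hsilent D P Q hD hN hmax)
    exact C.not_silences_of_connected hn2 hnoise hsupp hx hy h1 h2 hall
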